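/- Let $\Gamma$ be a finite, connected, simple metric graph (no loops, no multiple edges) with vertices $v_1,\dots,v_n$ and edges $e_1,\dots,e_N$, where each edge $e$ has a positive length $l_e$ and is identified with the interval $[0,l_e]$. Assume that $\Gamma$ is equilateral (all edges have the same length) and not bipartite. Let $L^{st}(\Gamma)$ and $L^{a/st}(\Gamma)$ be the operators $f\mapsto -f''$ (edge by edge) in the real Hilbert space $L^2(\Gamma)=\bigoplus_e L^2[0,l_e]$, whose domains consist of all $f$ such that, on every edge, $f$ and $f'$ are absolutely continuous and $f''\in L^2$, and such that at every vertex $v$ the following conditions hold, where derivatives at $v$ are taken along the edges in the outgoing direction: - for $L^{st}(\Gamma)$ (standard conditions): the values of $f$ at $v$ along all edges incident to $v$ coincide, and the derivatives at $v$ along these edges sum up to $0$; - for $L^{a/st}(\Gamma)$ (anti-standard conditions): the derivatives of $f$ at $v$ along all edges incident to $v$ coincide, and the values of $f$ at $v$ along these edges sum up to $0$. For $k=1,2,\dots$ let $\lambda_k(L)$ be the $k$-th smallest eigenvalue of $L$, counted with multiplicity. Let $A$ be the adjacency matrix of $\Gamma$, let $Z=\mathrm{Diag}(A\mathbf 1)^{-1}A$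 be its transition matrix, where $\mathbf 1$ is the all-ones vector, and let $\mu_1\ge\mu_2\ge\dots\ge\mu_n$ be the eigenvalues of $Z$, counted with multiplicity (they are real, with $1=\mu_1>\mu_2$ and $\mu_n>-1$). Then $$\lambda_{k+1}(L^{st}(\Gamma))\ \ge\ \lambda_{k+N-n}(L^{a/st}(\Gamma))\qquad\text{for all integers } k\ge 1$$ if and only if both $$\mu_j\le-\mu_{n+2-j}\quad\text{for all } 2\le j\le n \qquad\text{and}\qquad \mu_j\ge-\mu_{n-j}\quad\text{for all } 2\le j\le n-2 .$$ -/

import Mathlib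

open MeasureTheory

/-- A metric graph with vertex set `V` and edge set `E`: each edge `e` has a starting vertex `o e`,
an ending vertex `t e` and a positive length, and is identified with the interval `[0, len e]`.
The graph has no loops and no multiple edges, and it is connected. -/
structure MetricGraph (V E : Type*) where
  o : E → V
  t : E → V
  len : E → ℝ
  len_pos : ∀ e, 0 < len e
  no_loop : ∀ e, o e ≠ t e
  no_multi : ∀ e e', s(o e, t e) = s(o e', t e') → e = e'
  connected : (SimpleGraph.fromRel fun v w => ∃ e, o e = v ∧ t e = w).Connected

namespace MetricGraph

variable {V E : Type*} (Γ : MetricGraph V E)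

/-- The underlying simple graph: two vertices are adjacent iff an edge joins them. -/
def graph : SimpleGraph V :=
  SimpleGraph.fromRel fun v w => ∃ e, Γ.o e = v ∧ Γ.t e = w

/-- All edges have the same length. -/
def IsEquilateral : Prop := ∀ e e', Γ.len e = Γ.len e'

/-- The edge `e` has the vertex `v` as one of its two ends. -/
def Incident (e : E) (v : V) : Prop := Γ.o e = v ∨ Γ.t e = v

section transition

variable [Fintype V]

open Classical in
/-- The transition matrix `Z = Diag(A 1)⁻¹ A`, where `A` is the adjacency matrix. -/
noncomputable def transitionMatrix : Matrix V V ℝ :=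
  (Matrix.diagonal (Matrix.mulVec (Γ.graph.adjMatrix ℝ) 1))⁻¹ * Γ.graph.adjMatrix ℝ

open Classical in
/-- `Γ.transitionEigenvalue j` is the `j`-th largest eigenvalue `μ_j` of the transition matrix,
`1 ≤ j ≤ n`, counted with multiplicity. -/
noncomputable def transitionEigenvalue (j : ℕ) : ℝ :=
  (Γ.transitionMatrix.charpoly.roots.sort (· ≥ ·)).getD (j - 1) 0

end transition

open Classical in
/-- The value at the vertex `v` of the function `f` along the edge `e`, for `e` incident to `v`. -/
noncomputable def valueAt (f : E → ℝ → ℝ) (e : E) (v : V) : ℝ :=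
  if Γ.o e = v then f e 0 else f e (Γ.len e)

open Classical in
/-- The outgoing derivative at `v` along the edge `e`, for `e` incident to `v`, of a function on
the graph whose derivative on the edges is `g`. -/
noncomputable def outDerivAt (g : E → ℝ → ℝ) (e : E) (v : V) : ℝ :=
  if Γ.o e = v then g e 0 else -g e (Γ.len e)

/-- The real Hilbert space `L²(Γ) = ⨁ₑ L²[0, len e]`. -/
abbrev L2 : Type _ :=
  PiLp 2 fun e : E => Lp ℝ 2 (volume.restrict (Set.Icc (0 : ℝ) (Γ.len e)))

/-- `u ∈ L²(Γ)` is represented by `f`, where on each edge `f` is differentiable with derivative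
`g`, both `f` and `g` are absolutely continuous, and `w = -f''` almost everywhere. Since `w` is
an element of `L²(Γ)`, this says that `u` is in the domain of the maximal Laplace operator, which
maps `u` to `w`. -/
structure IsMaxLaplace (f g : E → ℝ → ℝ) (u w : Γ.L2) : Prop where
  ac : ∀ e, AbsolutelyContinuousOnInterval (f e) 0 (Γ.len e)
  ac_deriv : ∀ e, AbsolutelyContinuousOnInterval (g e) 0 (Γ.len e)
  hasDeriv : ∀ e, ∀ x ∈ Set.Icc 0 (Γ.len e),
    HasDerivWithinAt (f e) (g e x) (Set.Icc 0 (Γ.len e)) x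
  rep : ∀ e, ∀ᵐ x ∂(volume.restrict (Set.Icc 0 (Γ.len e))), u e x = f e x
  eqn : ∀ e, ∀ᵐ x ∂(volume.restrict (Set.Icc 0 (Γ.len e))), HasDerivAt (g e) (-(w e x)) x

open Classical in
/-- Standard (Kirchhoff) vertex conditions on a function `f` with derivative `g`: continuity at
every vertex, and the outgoing derivatives sum up to zero at every vertex. -/
def standardConditions [Fintype E] : Submodule ℝ ((E → ℝ → ℝ) × (E → ℝ → ℝ)) where
  carrier := {p | ∀ v,
    (∀ e e', Γ.Incident e v → Γ.Incident e' v → Γ.valueAt p.1 e v = Γ.valueAt p.1 e' v) ∧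
    ∑ e with Γ.Incident e v, Γ.outDerivAt p.2 e v = 0}
  zero_mem' := by intro v; simp [valueAt, outDerivAt]
  add_mem' := by
    intro p q hp hq v
    have h1 : ∀ e, Γ.valueAt (p + q).1 e v = Γ.valueAt p.1 e v + Γ.valueAt q.1 e v := by
      intro e; unfold valueAt; split_ifs <;> simp
    have h2 : ∀ e, Γ.outDerivAt (p + q).2 e v = Γ.outDerivAt p.2 e v + Γ.outDerivAt q.2 e v := by
      intro e; unfold outDerivAt; split_ifs <;> simp [add_comm]
    refine ⟨fun e e' he he' => ?_, ?_⟩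
    · rw [h1, h1, (hp v).1 e e' he he', (hq v).1 e e' he he']
    · simp only [h2, Finset.sum_add_distrib, (hp v).2, (hq v).2, add_zero]
  smul_mem' := by
    intro c p hp v
    have h1 : ∀ e, Γ.valueAt (c • p).1 e v = c * Γ.valueAt p.1 e v := by
      intro e; unfold valueAt; split_ifs <;> simp
    have h2 : ∀ e, Γ.outDerivAt (c • p).2 e v = c * Γ.outDerivAt p.2 e v := by
      intro e; unfold outDerivAt; split_ifs <;> simp
    refine ⟨fun e e' he he' => ?_, ?_⟩
    · rw [h1, h1, (hp v).1 e e' he he']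
    · simp only [h2, ← Finset.mul_sum, (hp v).2, mul_zero]

open Classical in
/-- Anti-standard (anti-Kirchhoff) vertex conditions on a function `f` with derivative `g`: at
every vertex all outgoing derivatives coincide, and the values sum up to zero. -/
def antiStandardConditions [Fintype E] : Submodule ℝ ((E → ℝ → ℝ) × (E → ℝ → ℝ)) where
  carrier := {p | ∀ v,
    (∀ e e', Γ.Incident e v → Γ.Incident e' v →
      Γ.outDerivAt p.2 e v = Γ.outDerivAt p.2 e' v) ∧
    ∑ e with Γ.Incident e v, Γ.valueAt p.1 e v = 0}
  zero_mem' := by intro v; simp [valueAt, outDerivAt]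
  add_mem' := by
    intro p q hp hq v
    have h1 : ∀ e, Γ.valueAt (p + q).1 e v = Γ.valueAt p.1 e v + Γ.valueAt q.1 e v := by
      intro e; unfold valueAt; split_ifs <;> simp
    have h2 : ∀ e, Γ.outDerivAt (p + q).2 e v = Γ.outDerivAt p.2 e v + Γ.outDerivAt q.2 e v := by
      intro e; unfold outDerivAt; split_ifs <;> simp [add_comm]
    refine ⟨fun e e' he he' => ?_, ?_⟩
    · rw [h2, h2, (hp v).1 e e' he he', (hq v).1 e e' he he']
    · simp only [h1, Finset.sum_add_distrib, (hp v).2, (hq v).2, add_zero]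
  smul_mem' := by
    intro c p hp v
    have h1 : ∀ e, Γ.valueAt (c • p).1 e v = c * Γ.valueAt p.1 e v := by
      intro e; unfold valueAt; split_ifs <;> simp
    have h2 : ∀ e, Γ.outDerivAt (c • p).2 e v = c * Γ.outDerivAt p.2 e v := by
      intro e; unfold outDerivAt; split_ifs <;> simp
    refine ⟨fun e e' he he' => ?_, ?_⟩
    · rw [h2, h2, (hp v).1 e e' he he']
    · simp only [h1, ← Finset.mul_sum, (hp v).2, mul_zero]

/-- The graph `{(u, -u'')}` of the Laplace operator with vertex conditions `C`. -/
def laplaceGraph (C : Submodule ℝ ((E → ℝ → ℝ) × (E → ℝ → ℝ))) :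
    Submodule ℝ (Γ.L2 × Γ.L2) where
  carrier := {p | ∃ f g, (f, g) ∈ C ∧ Γ.IsMaxLaplace f g p.1 p.2}
  zero_mem' := by
    refine ⟨0, 0, C.zero_mem, ?_, ?_, ?_, ?_, ?_⟩
    · intro e
      exact (LipschitzWith.const (α := ℝ) (0 : ℝ)).lipschitzOnWith.absolutelyContinuousOnInterval
    · intro e
      exact (LipschitzWith.const (α := ℝ) (0 : ℝ)).lipschitzOnWith.absolutelyContinuousOnInterval
    · intro e x _
      exact hasDerivWithinAt_const x _ (0 : ℝ)
    · intro e
      exact Lp.coeFn_zero ℝ 2 _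
    · intro e
      filter_upwards [Lp.coeFn_zero ℝ 2 (volume.restrict (Set.Icc (0 : ℝ) (Γ.len e)))] with x hx
      have h0 : ((0 : Γ.L2 × Γ.L2).2 e : ℝ → ℝ) x = 0 := hx
      rw [h0, neg_zero]
      exact hasDerivAt_const x (0 : ℝ)
  add_mem' := by
    rintro p q ⟨f, g, hC, h⟩ ⟨f', g', hC', h'⟩
    refine ⟨f + f', g + g', C.add_mem hC hC', ?_, ?_, ?_, ?_, ?_⟩
    · exact fun e => (h.ac e).add (h'.ac e)
    · exact fun e => (h.ac_deriv e).add (h'.ac_deriv e)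
    · exact fun e x hx => (h.hasDeriv e x hx).add (h'.hasDeriv e x hx)
    · intro e
      filter_upwards [h.rep e, h'.rep e, Lp.coeFn_add (p.1 e) (q.1 e)] with x h1 h2 h3
      have h4 : ((p + q).1 e : ℝ → ℝ) x = (p.1 e + q.1 e : Lp ℝ 2 _) x := rfl
      rw [h4, h3, Pi.add_apply, h1, h2]
      rfl
    · intro e
      filter_upwards [h.eqn e, h'.eqn e, Lp.coeFn_add (p.2 e) (q.2 e)] with x h1 h2 h3
      have h4 : ((p + q).2 e : ℝ → ℝ) x = (p.2 e + q.2 e : Lp ℝ 2 _) x := rfl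
      have h5 : -((p + q).2 e : ℝ → ℝ) x = -p.2 e x + -q.2 e x := by
        rw [h4, h3, Pi.add_apply, neg_add]
      rw [h5]
      exact h1.add h2
  smul_mem' := by
    rintro c p ⟨f, g, hC, h⟩
    refine ⟨c • f, c • g, C.smul_mem c hC, ?_, ?_, ?_, ?_, ?_⟩
    · exact fun e => (h.ac e).const_mul c
    · exact fun e => (h.ac_deriv e).const_mul c
    · exact fun e x hx => (h.hasDeriv e x hx).const_mul c
    · intro e
      filter_upwards [h.rep e, Lp.coeFn_smul c (p.1 e)] with x h1 h3
      have h4 : ((c • p).1 e : ℝ → ℝ) x = (c • p.1 e : Lp ℝ 2 _) x := rfl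
      rw [h4, h3, Pi.smul_apply, h1]
      rfl
    · intro e
      filter_upwards [h.eqn e, Lp.coeFn_smul c (p.2 e)] with x h1 h3
      have h4 : ((c • p).2 e : ℝ → ℝ) x = (c • p.2 e : Lp ℝ 2 _) x := rfl
      have h5 : -((c • p).2 e : ℝ → ℝ) x = c * -p.2 e x := by
        rw [h4, h3, Pi.smul_apply, smul_eq_mul, mul_neg]
      rw [h5]
      exact h1.const_mul c

/-- `-u''` is determined by `u`, so that `laplaceGraph` is the graph of an operator. -/
theorem laplaceGraph_functional (C : Submodule ℝ ((E → ℝ → ℝ) × (E → ℝ → ℝ))) :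
    ∀ p ∈ Γ.laplaceGraph C, p.1 = 0 → p.2 = 0 := by
  rintro ⟨u, w⟩ ⟨f, g, -, h⟩ hu
  obtain rfl : u = 0 := hu
  have hf : ∀ e, Set.EqOn (f e) 0 (Set.Icc 0 (Γ.len e)) := by
    intro e
    refine Measure.eqOn_Icc_of_ae_eq volume (Γ.len_pos e).ne ?_ ?_ continuousOn_const
    · filter_upwards [h.rep e,
        Lp.coeFn_zero ℝ 2 (volume.restrict (Set.Icc (0 : ℝ) (Γ.len e)))] with x h1 h2
      rw [← h1]
      exact h2
    · exact fun x hx => (h.hasDeriv e x hx).continuousWithinAt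
  have hg : ∀ e, Set.EqOn (g e) 0 (Set.Icc 0 (Γ.len e)) := by
    intro e x hx
    have h1 : HasDerivWithinAt (f e) 0 (Set.Icc 0 (Γ.len e)) x :=
      (hasDerivWithinAt_const x _ (0 : ℝ)).congr (fun y hy => hf e hy) (hf e hx)
    exact (uniqueDiffOn_Icc (Γ.len_pos e) x hx).eq_deriv _ (h.hasDeriv e x hx) h1
  ext e : 1
  refine Lp.ext ?_
  filter_upwards [h.eqn e, ae_restrict_mem measurableSet_Icc,
    Lp.coeFn_zero ℝ 2 (volume.restrict (Set.Icc (0 : ℝ) (Γ.len e)))] with x h1 hx h2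
  have h3 : HasDerivWithinAt (g e) 0 (Set.Icc 0 (Γ.len e)) x :=
    (hasDerivWithinAt_const x _ (0 : ℝ)).congr (fun y hy => hg e hy) (hg e hx)
  have h4 := (uniqueDiffOn_Icc (Γ.len_pos e) x hx).eq_deriv _ h1.hasDerivWithinAt h3
  have h5 : w e x = 0 := neg_eq_zero.mp h4
  rw [h5]
  exact h2.symm

/-- The standard (Kirchhoff) Laplace operator on `L²(Γ)`. -/
noncomputable def standardLaplacian [Fintype E] : Γ.L2 →ₗ.[ℝ] Γ.L2 :=
  (Γ.laplaceGraph Γ.standardConditions).toLinearPMap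

/-- The anti-standard (anti-Kirchhoff) Laplace operator on `L²(Γ)`. -/
noncomputable def antiStandardLaplacian [Fintype E] : Γ.L2 →ₗ.[ℝ] Γ.L2 :=
  (Γ.laplaceGraph Γ.antiStandardConditions).toLinearPMap

end MetricGraph

namespace LinearPMap

variable {H : Type*} [AddCommGroup H] [Module ℝ H]

/-- The eigenspace `{u ∈ Dom T : T u = μ u}` of an unbounded operator. -/
def eigenspaceAt (T : H →ₗ.[ℝ] H) (μ : ℝ) : Submodule ℝ H where
  carrier := {u | ∃ hu : u ∈ T.domain, T ⟨u, hu⟩ = μ • u}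
  zero_mem' := ⟨T.domain.zero_mem, by
    rw [smul_zero]; exact T.map_zero⟩
  add_mem' := by
    rintro u v ⟨hu, h1⟩ ⟨hv, h2⟩
    refine ⟨T.domain.add_mem hu hv, ?_⟩
    rw [smul_add, ← h1, ← h2]
    exact T.map_add ⟨u, hu⟩ ⟨v, hv⟩
  smul_mem' := by
    rintro c u ⟨hu, h1⟩
    refine ⟨T.domain.smul_mem c hu, ?_⟩
    rw [smul_comm, ← h1]
    exact T.map_smul c ⟨u, hu⟩

/-- The number of eigenvalues `μ ≤ s` of `T`, counted with multiplicity: the sum of the dimensions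
of the corresponding eigenspaces. -/
noncomputable def eigenvalueCount (T : H →ₗ.[ℝ] H) (s : ℝ) : Cardinal :=
  Cardinal.sum fun μ : Set.Iic s => Module.rank ℝ (T.eigenspaceAt μ)

/-- `T.eigenvalueAt k` is the `k`-th smallest eigenvalue `λ_k(T)` of `T`, `k = 1, 2, …`, counted
with multiplicity: the smallest `s` such that at least `k` eigenvalues are `≤ s`. -/
noncomputable def eigenvalueAt (T : H →ₗ.[ℝ] H) (k : ℕ) : ℝ :=
  sInf {s : ℝ | (k : Cardinal) ≤ T.eigenvalueCount s}

end LinearPMap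

/-!
Let `l` be the common length, `n` and `N` the numbers of vertices and edges, `m = N - n`, and let
`R` be the multiset of the eigenvalues of the transition matrix other than the simple eigenvalue
`1`; all of them lie in `(-1, 1)`, since the graph is connected and not bipartite
(`abs_lt_one_of_mem_nontrivialRoots`).

On every edge an eigenfunction for `μ` is `a c + b s`, where `c`, `s` are the fundamental solutions
of `-f'' = μ f` (`IsFundamentalPair.eq_comb`), and the vertex conditions become linear conditions on
the coefficients `(a, b)`. Since `c² + μ s² = 1`, both kinds of conditions define a space of the
same form `vertexSpace c σ τ` with `c² + σ τ = 1`: the standard ones give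
`(c, s, μ s)`, the anti-standard ones, with `a` and `b` interchanged, `(-c, μ s, s)`, evaluated at
`l`. If `σ ≠ 0`, the coefficients are determined by the values on the vertices, and the dimension is
the multiplicity of `c` as an eigenvalue of the transition matrix (`finrank_vertexSpace`). If
`σ = 0`, then `c = ± 1`, and the dimension is `N - n` or `N - n + 2` by the rank of the unsigned and
of the signed incidence matrix. For `μ < 0` there is no eigenfunction, as `c = cosh > 1`.

With `μ = (θ / l)²` this gives the spectra: for standard conditions the solutions of `cos θ = c`,
`c ∈ R`, and the points `π i` with multiplicity `1` for `i = 0`, `m` for odd `i`, and `m + 2` for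
even `i > 0`; for anti-standard conditions the solutions of `cos θ = -c`, `c ∈ R`, and the points
`π i` with multiplicity `m` for even and `m + 2` for odd `i`. Every `c` in `(-1, 1)` is taken by the
cosine exactly once in each interval `(π i, π (i + 1))`, so that the number of eigenvalues up to
`θ = φ + q π`, `0 ≤ φ < π`, is explicit (`LinearPMap.IsTrigSpectrum.eigenvalueCount_eq`). The
inequalities between the eigenvalues say that the counting functions `F` and `F'` for standard and
anti-standard conditions satisfy `F + m ≤ F' + 1` wherever `F ≥ 2`. With `t = cos φ`, this is
`#{c ≥ t} ≤ #{c ≤ -t}` for even `q` and `#{c ≤ -t} ≤ #{c ≥ t} + 2` for odd `q`, with `c` in `R`.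
These inequalities for all `t` are the two families of inequalities between the sorted eigenvalues
(`Multiset.forall_descEntry_le_neg_iff`, `Multiset.forall_descEntry_ge_neg_iff`).
-/

/-! ### Sums over the ends of the edges, and connectedness -/

namespace MetricGraph

variable {V E : Type*} (Γ : MetricGraph V E)

open Classical in
/-- The sum at the vertex `v` of a quantity carried by the ends of the edges: `x e` sits at the
starting end of the edge `e` and `y e` at its final end. -/
noncomputable def endSum [Fintype E] (x y : E → ℝ) (v : V) : ℝ :=
  ∑ e, ((if Γ.o e = v then x e else 0) + if Γ.t e = v then y e else 0)

section endSum

variable [Fintype E]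

lemma endSum_add (x y x' y' : E → ℝ) (v : V) :
    Γ.endSum (x + x') (y + y') v = Γ.endSum x y v + Γ.endSum x' y' v := by
  unfold endSum
  rw [← Finset.sum_add_distrib]
  refine Finset.sum_congr rfl fun e _ => ?_
  split_ifs <;> simp [add_add_add_comm]

lemma endSum_smul (k : ℝ) (x y : E → ℝ) (v : V) :
    Γ.endSum (k • x) (k • y) v = k * Γ.endSum x y v := by
  unfold endSum
  rw [Finset.mul_sum]
  refine Finset.sum_congr rfl fun e _ => ?_
  split_ifs <;> simp [mul_add]

open Classical in
lemma sum_incident (h : E → V → ℝ) (v : V) :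
    ∑ e with Γ.Incident e v, h e v =
      Γ.endSum (fun e => h e (Γ.o e)) (fun e => h e (Γ.t e)) v := by
  unfold endSum
  rw [Finset.sum_filter]
  refine Finset.sum_congr rfl fun e _ => ?_
  have hne := Γ.no_loop e
  unfold Incident
  by_cases h1 : Γ.o e = v
  · have h2 : Γ.t e ≠ v := fun h2 => hne (h1.trans h2.symm)
    simp [h1, h2]
  · by_cases h2 : Γ.t e = v <;> simp [h1, h2]

lemma sum_mul_endSum [Fintype V] (φ : V → ℝ) (x y : E → ℝ) :
    ∑ v, φ v * Γ.endSum x y v = ∑ e, (φ (Γ.o e) * x e + φ (Γ.t e) * y e) := by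
  classical
  unfold endSum
  simp_rw [Finset.mul_sum]
  rw [Finset.sum_comm]
  refine Finset.sum_congr rfl fun e _ => ?_
  simp [mul_add, Finset.sum_add_distrib]

lemma endSum_comp (φ : V → ℝ) (x y : E → ℝ) (v : V) :
    Γ.endSum (fun e => φ (Γ.o e) * x e) (fun e => φ (Γ.t e) * y e) v
      = φ v * Γ.endSum x y v := by
  unfold endSum
  rw [Finset.mul_sum]
  refine Finset.sum_congr rfl fun e _ => ?_
  split_ifs <;> simp_all [mul_add]

end endSum

lemma adj_iff {v w : V} : Γ.graph.Adj v w ↔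
    ∃ e, (Γ.o e = v ∧ Γ.t e = w) ∨ (Γ.o e = w ∧ Γ.t e = v) := by
  unfold graph
  rw [SimpleGraph.fromRel_adj]
  constructor
  · rintro ⟨-, ⟨e, h⟩ | ⟨e, h⟩⟩
    exacts [⟨e, Or.inl h⟩, ⟨e, Or.inr h⟩]
  · rintro ⟨e, ⟨rfl, rfl⟩ | ⟨rfl, rfl⟩⟩
    exacts [⟨Γ.no_loop e, Or.inl ⟨e, rfl, rfl⟩⟩, ⟨(Γ.no_loop e).symm, Or.inr ⟨e, rfl, rfl⟩⟩]

/-- Connectedness: a vertex function that agrees at the two ends of every edge is constant. -/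
lemma eq_of_forall_edge {X : Type*} {φ : V → X} (h : ∀ e, φ (Γ.o e) = φ (Γ.t e)) (v w : V) :
    φ v = φ w := by
  obtain ⟨p⟩ := Γ.connected.preconnected v w
  induction p with
  | nil => rfl
  | cons hadj _ ih =>
    refine Eq.trans ?_ ih
    obtain ⟨e, ⟨rfl, rfl⟩ | ⟨rfl, rfl⟩⟩ := Γ.adj_iff.mp hadj
    exacts [h e, (h e).symm]

/-- On a connected graph that is not bipartite, a vertex function that changes sign along every
edge vanishes: otherwise its sign would be a proper 2-colouring. -/
lemma eq_zero_of_forall_edge_neg (hbip : ¬ Γ.graph.IsBipartite) {φ : V → ℝ}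
    (h : ∀ e, φ (Γ.t e) = -φ (Γ.o e)) : φ = 0 := by
  by_contra hne
  obtain ⟨v₀, hv₀⟩ := Function.ne_iff.mp hne
  have habs : ∀ v, |φ v| = |φ v₀| := fun v =>
    Γ.eq_of_forall_edge (φ := fun v => |φ v|) (fun e => by simp [h e]) v v₀
  have hnz : ∀ v, φ v ≠ 0 := fun v hv => hv₀ (by
    have := habs v
    rw [hv, abs_zero] at this
    exact abs_eq_zero.mp this.symm)
  apply hbip
  refine ⟨SimpleGraph.Coloring.mk (fun v => if 0 < φ v then (0 : Fin 2) else 1) ?_⟩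
  intro v w hadj
  have hvw : φ w = -φ v := by
    obtain ⟨e, ⟨rfl, rfl⟩ | ⟨rfl, rfl⟩⟩ := Γ.adj_iff.mp hadj
    · exact h e
    · rw [h e, neg_neg]
  rcases lt_or_gt_of_ne (hnz v) with h1 | h1
  · have h2 : 0 < φ w := by linarith
    simp [h1.not_gt, h2]
  · have h2 : ¬ 0 < φ w := by linarith
    simp [h1, h2]

lemma nonempty_edge (hbip : ¬ Γ.graph.IsBipartite) : Nonempty E := by
  by_contra hE
  rw [not_nonempty_iff] at hE
  obtain ⟨v⟩ := Γ.connected.nonempty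
  have := Γ.eq_zero_of_forall_edge_neg hbip (φ := 1) (fun e => isEmptyElim e)
  exact one_ne_zero (congrFun this v)

/-! ### Coefficient spaces and the incidence matrices -/

/-- The space of coefficients `(a, b)`, one pair for each edge, such that the numbers `a e` and
`c * a e + σ * b e` at the two ends of the edges are the values of a function on the vertices,
and the numbers `b e` and `τ * a e - c * b e` at the two ends sum up to zero at every vertex.
For suitable `c`, `σ`, `τ` these are the vertex conditions of either kind on the solutions of
`-f'' = μ f` with `f 0` and `f' 0` equal to `a e` and `b e`, or to `b e` and `a e`. -/
def vertexSpace [Fintype E] (c σ τ : ℝ) : Submodule ℝ ((E → ℝ) × (E → ℝ)) where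
  carrier := {p | (∃ φ : V → ℝ, ∀ e, φ (Γ.o e) = p.1 e ∧ φ (Γ.t e) = c * p.1 e + σ * p.2 e) ∧
    ∀ v, Γ.endSum p.2 (τ • p.1 - c • p.2) v = 0}
  zero_mem' := ⟨⟨0, by simp⟩, by simp [endSum]⟩
  add_mem' := by
    rintro p q ⟨⟨φ, hφ⟩, hp⟩ ⟨⟨ψ, hψ⟩, hq⟩
    refine ⟨⟨φ + ψ, fun e => ⟨by simp [hφ, hψ], ?_⟩⟩, fun v => ?_⟩
    · simp only [Pi.add_apply, hφ, hψ, Prod.fst_add, Prod.snd_add]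
      ring
    · have : τ • (p + q).1 - c • (p + q).2 = (τ • p.1 - c • p.2) + (τ • q.1 - c • q.2) := by
        simp only [Prod.fst_add, Prod.snd_add, smul_add]
        abel
      rw [this, Prod.snd_add, endSum_add, hp, hq, add_zero]
  smul_mem' := by
    rintro k p ⟨⟨φ, hφ⟩, hp⟩
    refine ⟨⟨k • φ, fun e => ⟨by simp [hφ], ?_⟩⟩, fun v => ?_⟩
    · simp only [Pi.smul_apply, hφ, Prod.smul_fst, Prod.smul_snd, smul_eq_mul]
      ring
    · have : τ • (k • p).1 - c • (k • p).2 = k • (τ • p.1 - c • p.2) := by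
        simp only [Prod.smul_fst, Prod.smul_snd, smul_sub, smul_comm k]
      rw [this, Prod.smul_snd, endSum_smul, hp, mul_zero]

section incidence

open Classical in
/-- The incidence matrix of the graph in which the final end of every edge has the weight `ε`:
it is unsigned for `ε = 1` and signed for `ε = -1`. -/
noncomputable def incidenceMatrix (ε : ℝ) : Matrix V E ℝ := fun v e =>
  (if Γ.o e = v then 1 else 0) + if Γ.t e = v then ε else 0

lemma incidenceMatrix_mulVec [Fintype E] (ε : ℝ) (x : E → ℝ) :
    (Γ.incidenceMatrix ε).mulVec x = Γ.endSum x (ε • x) := by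
  ext v
  unfold incidenceMatrix endSum Matrix.mulVec dotProduct
  refine Finset.sum_congr rfl fun e _ => ?_
  beta_reduce
  split_ifs <;> simp [add_mul]

variable [Fintype V]

lemma incidenceMatrix_transpose_mulVec (ε : ℝ) (φ : V → ℝ) (e : E) :
    (Γ.incidenceMatrix ε).transpose.mulVec φ e = φ (Γ.o e) + ε * φ (Γ.t e) := by
  classical
  simp [incidenceMatrix, Matrix.mulVec, dotProduct, Matrix.transpose_apply, add_mul,
    Finset.sum_add_distrib]

/-- Rank-nullity for the incidence matrix and for its transpose, which have the same rank. -/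
lemma finrank_ker_incidenceMatrix [Fintype E] (ε : ℝ) :
    Module.finrank ℝ (Γ.incidenceMatrix ε).mulVecLin.ker + Fintype.card V =
      Fintype.card E + Module.finrank ℝ (Γ.incidenceMatrix ε).transpose.mulVecLin.ker := by
  have h1 := (Γ.incidenceMatrix ε).mulVecLin.finrank_range_add_finrank_ker
  have h2 := (Γ.incidenceMatrix ε).transpose.mulVecLin.finrank_range_add_finrank_ker
  have h3 := (Γ.incidenceMatrix ε).rank_transpose
  unfold Matrix.rank at h3
  rw [Module.finrank_pi] at h1 h2
  omega

/-- The cycle space has dimension `N - n + 1`. -/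
lemma finrank_ker_incidenceMatrix_neg_one [Fintype E] :
    Module.finrank ℝ (Γ.incidenceMatrix (-1)).mulVecLin.ker + Fintype.card V =
      Fintype.card E + 1 := by
  rw [finrank_ker_incidenceMatrix]
  congr 1
  rw [finrank_eq_one_iff']
  obtain ⟨v₀⟩ := Γ.connected.nonempty
  refine ⟨⟨1, ?_⟩, ?_, ?_⟩
  · rw [LinearMap.mem_ker, Matrix.mulVecLin_apply]
    ext e
    simp [incidenceMatrix_transpose_mulVec]
  · intro h
    have := congrFun (congrArg Subtype.val h) v₀
    simp at this
  · rintro ⟨φ, hφ⟩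
    refine ⟨φ v₀, Subtype.ext (funext fun v => ?_)⟩
    rw [LinearMap.mem_ker, Matrix.mulVecLin_apply] at hφ
    have : φ v₀ = φ v := Γ.eq_of_forall_edge (fun e => by
      have := congrFun hφ e
      rw [incidenceMatrix_transpose_mulVec, Pi.zero_apply] at this
      linarith) v₀ v
    simp [this]

lemma finrank_ker_incidenceMatrix_one [Fintype E] (hbip : ¬ Γ.graph.IsBipartite) :
    Module.finrank ℝ (Γ.incidenceMatrix 1).mulVecLin.ker + Fintype.card V = Fintype.card E := by
  rw [finrank_ker_incidenceMatrix]
  have : (Γ.incidenceMatrix 1).transpose.mulVecLin.ker = ⊥ := by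
    rw [eq_bot_iff]
    intro φ hφ
    rw [LinearMap.mem_ker, Matrix.mulVecLin_apply] at hφ
    refine Γ.eq_zero_of_forall_edge_neg hbip fun e => ?_
    have := congrFun hφ e
    rw [incidenceMatrix_transpose_mulVec, Pi.zero_apply] at this
    linarith
  rw [this, finrank_bot, add_zero]

lemma card_vertex_le_card_edge [Fintype E] (hbip : ¬ Γ.graph.IsBipartite) :
    Fintype.card V ≤ Fintype.card E := by
  have := Γ.finrank_ker_incidenceMatrix_one hbip
  omega

/-- The values on the vertices change sign along every edge and hence vanish; what remains is the
kernel of the unsigned incidence matrix. -/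
lemma finrank_vertexSpace_neg_one [Fintype E] (hbip : ¬ Γ.graph.IsBipartite) (τ : ℝ) :
    Module.finrank ℝ (Γ.vertexSpace (-1) 0 τ) = Fintype.card E - Fintype.card V := by
  have h : Γ.vertexSpace (-1) 0 τ =
      (Γ.incidenceMatrix 1).mulVecLin.ker.map (LinearMap.inr ℝ (E → ℝ) (E → ℝ)) := by
    ext ⟨a, b⟩
    constructor
    · rintro ⟨⟨φ, hφ⟩, hs⟩
      have hφ0 : φ = 0 := Γ.eq_zero_of_forall_edge_neg hbip fun e => by
        rw [(hφ e).2, (hφ e).1]; ring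
      have ha : a = 0 := funext fun e => by simpa [hφ0] using (hφ e).1.symm
      subst ha
      refine ⟨b, ?_, rfl⟩
      rw [SetLike.mem_coe, LinearMap.mem_ker, Matrix.mulVecLin_apply, incidenceMatrix_mulVec]
      ext v
      simpa using hs v
    · rintro ⟨x, hx, hxe⟩
      rw [SetLike.mem_coe, LinearMap.mem_ker, Matrix.mulVecLin_apply, incidenceMatrix_mulVec] at hx
      obtain ⟨rfl, rfl⟩ : 0 = a ∧ x = b := by simpa [Prod.ext_iff] using hxe
      refine ⟨⟨0, by simp⟩, fun v => ?_⟩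
      simpa using congrFun hx v
  rw [h, ← (Submodule.equivMapOfInjective _ LinearMap.inr_injective _).finrank_eq]
  have := Γ.finrank_ker_incidenceMatrix_one hbip
  omega

/-- The values on the vertices are constant, and `b` is in the kernel of the signed incidence
matrix. -/
lemma finrank_vertexSpace_one [Fintype E] [Nonempty E] (hbip : ¬ Γ.graph.IsBipartite) :
    Module.finrank ℝ (Γ.vertexSpace 1 0 0) = Fintype.card E - Fintype.card V + 2 := by
  let K := (Γ.incidenceMatrix (-1)).mulVecLin.ker
  let F : ℝ × K →ₗ[ℝ] (E → ℝ) × (E → ℝ) :=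
    LinearMap.prodMap (LinearMap.pi fun _ => LinearMap.id) K.subtype
  have hF : ∀ p, F p = (fun _ => p.1, p.2.1) := fun p => rfl
  have hinj : Function.Injective F := by
    rintro ⟨k, x⟩ ⟨k', x'⟩ h
    rw [hF, hF, Prod.mk.injEq] at h
    obtain ⟨e⟩ := ‹Nonempty E›
    exact Prod.ext (congrFun h.1 e) (Subtype.ext h.2)
  have h : Γ.vertexSpace 1 0 0 = F.range := by
    ext ⟨a, b⟩
    constructor
    · rintro ⟨⟨φ, hφ⟩, hs⟩
      have hc : ∀ v w, φ v = φ w := Γ.eq_of_forall_edge fun e => by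
        rw [(hφ e).2, (hφ e).1]; ring
      obtain ⟨v₀⟩ := Γ.connected.nonempty
      refine ⟨(φ v₀, ⟨b, ?_⟩), ?_⟩
      · rw [LinearMap.mem_ker, Matrix.mulVecLin_apply, incidenceMatrix_mulVec]
        ext v
        simpa using hs v
      · rw [hF]
        refine Prod.ext (funext fun e => ?_) rfl
        exact (hc v₀ _).trans (hφ e).1
    · rintro ⟨⟨k, ⟨x, hx⟩⟩, hp⟩
      rw [hF, Prod.mk.injEq] at hp
      obtain ⟨rfl, rfl⟩ := hp
      rw [LinearMap.mem_ker, Matrix.mulVecLin_apply, incidenceMatrix_mulVec] at hx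
      exact ⟨⟨fun _ => k, by simp⟩, fun v => by simpa using congrFun hx v⟩
  rw [h, LinearMap.finrank_range_of_inj hinj, Module.finrank_prod, Module.finrank_self]
  have h1 := Γ.finrank_ker_incidenceMatrix_neg_one
  have h2 := Γ.card_vertex_le_card_edge hbip
  change 1 + Module.finrank ℝ (Γ.incidenceMatrix (-1)).mulVecLin.ker = _
  omega

end incidence

end MetricGraph

/-! ### Spectrum of the transition matrix -/

/-- For a real symmetric matrix the geometric multiplicity of an eigenvalue is its multiplicity as
a root of the characteristic polynomial. -/
lemma Matrix.IsHermitian.rank_sub_smul_one_add_count {n : Type*} [Fintype n] [DecidableEq n]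
    {S : Matrix n n ℝ} (hS : S.IsHermitian) (c : ℝ) :
    (S - c • (1 : Matrix n n ℝ)).rank + S.charpoly.roots.count c = Fintype.card n := by
  set U : Matrix n n ℝ := (hS.eigenvectorUnitary : Matrix n n ℝ) with hU
  have hUU : U * star U = 1 := Unitary.coe_mul_star_self hS.eigenvectorUnitary
  have hdet : IsUnit U.det := by
    rw [← Matrix.isUnit_iff_isUnit_det]
    exact IsUnit.of_mul_eq_one _ hUU
  have hdet' : IsUnit (star U).det := by
    rw [← Matrix.isUnit_iff_isUnit_det]
    exact IsUnit.of_mul_eq_one _ (Unitary.coe_star_mul_self hS.eigenvectorUnitary)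
  have h1 : S - c • (1 : Matrix n n ℝ) =
      U * Matrix.diagonal (fun i => hS.eigenvalues i - c) * star U := by
    have h2 : Matrix.diagonal (fun i => hS.eigenvalues i - c) =
        Matrix.diagonal (RCLike.ofReal ∘ hS.eigenvalues) - c • (1 : Matrix n n ℝ) := by
      ext i j
      by_cases hij : i = j
      · subst hij; simp
      · simp [hij]
    rw [h2, mul_sub, sub_mul, Matrix.mul_smul, mul_one, Matrix.smul_mul, hUU]
    congr 1
    exact hS.spectral_theorem
  rw [h1, Matrix.rank_mul_eq_left_of_isUnit_det _ _ hdet',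
    Matrix.rank_mul_eq_right_of_isUnit_det _ _ hdet, Matrix.rank_diagonal,
    hS.roots_charpoly_eq_eigenvalues, Multiset.count_map, Fintype.card_subtype]
  rw [← Finset.card_univ, ← Finset.card_filter_add_card_filter_not
    (s := Finset.univ) (fun i => hS.eigenvalues i - c ≠ 0)]
  congr 1
  rw [← Finset.filter_val, Finset.card_val]
  congr 1
  ext i
  simp [eq_comm (a := c), sub_eq_zero]

namespace MetricGraph

variable {V E : Type*} [Fintype E] (Γ : MetricGraph V E)

/-- The degrees of the vertices. -/
noncomputable def deg : V → ℝ := Γ.endSum 1 1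

lemma deg_pos [Nonempty E] (v : V) : 0 < Γ.deg v := by
  classical
  unfold deg endSum
  have hnn : ∀ e : E, (0 : ℝ) ≤ (if Γ.o e = v then (1 : E → ℝ) e else 0) +
      if Γ.t e = v then (1 : E → ℝ) e else 0 := by
    intro e; split_ifs <;> simp
  refine (Finset.sum_nonneg fun e _ => hnn e).lt_of_ne fun h0 => ?_
  rw [eq_comm, Finset.sum_eq_zero_iff_of_nonneg fun e _ => hnn e] at h0
  have h1 : ∀ e, Γ.o e ≠ v ∧ Γ.t e ≠ v := by
    intro e
    have h2 := h0 e (Finset.mem_univ e)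
    constructor <;> intro h3 <;> simp only [h3, if_true, Pi.one_apply] at h2 <;>
      split_ifs at h2 <;> norm_num at h2
  -- an isolated vertex would be cut off from the ends of the edges
  obtain ⟨e⟩ := ‹Nonempty E›
  have h3 := Γ.eq_of_forall_edge (φ := fun w => w = v)
    (fun e => by simp [(h1 e).1, (h1 e).2]) v (Γ.o e)
  simp [(h1 e).1] at h3

variable [Fintype V]

open Classical in
lemma adjMatrix_mulVec (φ : V → ℝ) :
    (Γ.graph.adjMatrix ℝ).mulVec φ = Γ.endSum (fun e => φ (Γ.t e)) (fun e => φ (Γ.o e)) := by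
  have hA : ∀ v w, Γ.graph.adjMatrix ℝ v w =
      ∑ e, ((if Γ.o e = v then if Γ.t e = w then 1 else 0 else 0) +
        if Γ.t e = v then if Γ.o e = w then 1 else 0 else 0) := by
    intro v w
    rw [SimpleGraph.adjMatrix_apply]
    by_cases h : Γ.graph.Adj v w
    · obtain ⟨e, he⟩ := Γ.adj_iff.mp h
      rw [if_pos h, Finset.sum_eq_single e]
      · have hne := Γ.no_loop e
        rcases he with ⟨rfl, rfl⟩ | ⟨rfl, rfl⟩ <;> simp [hne, hne.symm]
      · intro e' _ hee'
        have h1 : ¬ (Γ.o e' = v ∧ Γ.t e' = w) := by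
          rintro ⟨h1, h2⟩
          refine hee' (Γ.no_multi _ _ ?_)
          rcases he with ⟨h3, h4⟩ | ⟨h3, h4⟩ <;> simp [h1, h2, h3, h4]
        have h2 : ¬ (Γ.t e' = v ∧ Γ.o e' = w) := by
          rintro ⟨h1, h2⟩
          refine hee' (Γ.no_multi _ _ ?_)
          rcases he with ⟨h3, h4⟩ | ⟨h3, h4⟩ <;> simp [h1, h2, h3, h4]
        rw [← ite_and, ← ite_and, if_neg h1, if_neg h2, add_zero]
      · simp
    · rw [if_neg h]
      refine (Finset.sum_eq_zero fun e _ => ?_).symm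
      have h' := fun e he => h (Γ.adj_iff.mpr ⟨e, he⟩)
      rw [← ite_and, ← ite_and, if_neg fun h1 => h' e (Or.inl h1),
        if_neg fun h1 => h' e (Or.inr ⟨h1.2, h1.1⟩), add_zero]
  ext v
  unfold Matrix.mulVec dotProduct endSum
  simp_rw [hA, Finset.sum_mul]
  rw [Finset.sum_comm]
  refine Finset.sum_congr rfl fun e _ => ?_
  split_ifs <;> simp [add_mul, Finset.sum_add_distrib]

open Classical in
/-- `A - c • D`, where `A` is the adjacency matrix and `D` the diagonal matrix of the degrees. -/
noncomputable def pencil (c : ℝ) : Matrix V V ℝ :=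
  Γ.graph.adjMatrix ℝ - c • Matrix.diagonal Γ.deg

lemma pencil_mulVec (c : ℝ) (φ : V → ℝ) (v : V) :
    (Γ.pencil c).mulVec φ v = Γ.endSum (fun e => φ (Γ.t e) - c * φ (Γ.o e))
      (fun e => φ (Γ.o e) - c * φ (Γ.t e)) v := by
  classical
  have h1 : (Γ.pencil c).mulVec φ v = Γ.endSum (fun e => φ (Γ.t e)) (fun e => φ (Γ.o e)) v -
      c * (φ v * Γ.deg v) := by
    unfold pencil
    rw [Matrix.sub_mulVec, Matrix.smul_mulVec, ← adjMatrix_mulVec]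
    simp [Matrix.mulVec_diagonal, mul_comm]
  have h2 := Γ.endSum_comp φ 1 1 v
  rw [h1, deg, ← h2, sub_eq_add_neg, ← neg_mul, ← endSum_smul, ← endSum_add]
  congr 1 <;> ext e <;> simp [sub_eq_add_neg]

open Classical in
/-- The eigenvalues of the transition matrix, counted with multiplicity. -/
noncomputable def transitionRoots : Multiset ℝ := Γ.transitionMatrix.charpoly.roots

open Classical in
/-- `D^(-1/2) A D^(-1/2)` is symmetric, similar to the transition matrix `D⁻¹ A`, and congruent to
the pencil `A - c D` after subtraction of `c`. -/
lemma finrank_ker_pencil_and_card [Nonempty E] (c : ℝ) :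
    Module.finrank ℝ (Γ.pencil c).mulVecLin.ker = Γ.transitionRoots.count c ∧
      Γ.transitionRoots.card = Fintype.card V := by
  set A := Γ.graph.adjMatrix ℝ with hA
  set r : Matrix V V ℝ := Matrix.diagonal fun v => (√(Γ.deg v))⁻¹ with hr
  have hsq : ∀ v, (√(Γ.deg v))⁻¹ * (√(Γ.deg v))⁻¹ = (Γ.deg v)⁻¹ := fun v => by
    rw [← mul_inv, Real.mul_self_sqrt (Γ.deg_pos v).le]
  have hdeg : A.mulVec 1 = Γ.deg := by
    rw [hA, adjMatrix_mulVec]; rfl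
  have hDinv : (Matrix.diagonal Γ.deg)⁻¹ = r * r := by
    refine Matrix.inv_eq_right_inv ?_
    rw [hr, Matrix.diagonal_mul_diagonal, Matrix.diagonal_mul_diagonal, ← Matrix.diagonal_one]
    congr 1
    ext v
    rw [hsq, mul_inv_cancel₀ (Γ.deg_pos v).ne']
  have hZ : Γ.transitionMatrix = r * (r * A) := by
    unfold transitionMatrix
    rw [← hA, hdeg, hDinv, mul_assoc]
  set S := r * A * r with hSdef
  have hS : S.IsHermitian := by
    unfold Matrix.IsHermitian
    have h1 : A.conjTranspose = A := by
      rw [Matrix.conjTranspose_eq_transpose_of_trivial, hA, SimpleGraph.transpose_adjMatrix]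
    have h2 : r.conjTranspose = r := by
      rw [Matrix.conjTranspose_eq_transpose_of_trivial, hr, Matrix.diagonal_transpose]
    rw [hSdef, Matrix.conjTranspose_mul, Matrix.conjTranspose_mul, h1, h2, mul_assoc]
  have hchar : Γ.transitionMatrix.charpoly = S.charpoly := by
    rw [hZ, Matrix.charpoly_mul_comm]
  have hrdet : IsUnit r.det := by
    rw [hr, Matrix.det_diagonal, isUnit_iff_ne_zero]
    refine Finset.prod_ne_zero_iff.mpr fun v _ => ?_
    exact inv_ne_zero (Real.sqrt_pos.mpr (Γ.deg_pos v)).ne'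
  have hrank : (Γ.pencil c).rank = (S - c • (1 : Matrix V V ℝ)).rank := by
    have : S - c • (1 : Matrix V V ℝ) = r * Γ.pencil c * r := by
      unfold pencil
      rw [mul_sub, sub_mul, ← hA, ← hSdef]
      congr 1
      rw [Matrix.mul_smul, Matrix.smul_mul, hr, Matrix.diagonal_mul_diagonal,
        Matrix.diagonal_mul_diagonal, ← Matrix.diagonal_one]
      congr 2
      ext v
      rw [mul_right_comm, hsq, inv_mul_cancel₀ (Γ.deg_pos v).ne']
    rw [this, Matrix.rank_mul_eq_left_of_isUnit_det _ _ hrdet,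
      Matrix.rank_mul_eq_right_of_isUnit_det _ _ hrdet]
  constructor
  · have h1 := hS.rank_sub_smul_one_add_count c
    have h2 := (Γ.pencil c).mulVecLin.finrank_range_add_finrank_ker
    rw [Module.finrank_pi] at h2
    rw [← hrank] at h1
    rw [transitionRoots, hchar]
    unfold Matrix.rank at h1
    omega
  · rw [transitionRoots, hchar, hS.roots_charpoly_eq_eigenvalues]
    simp

/-- For `σ ≠ 0` the coefficients are determined by the values on the vertices, and by
`c² + σ τ = 1` the condition on the sums says that these values are in the kernel of `A - c D`. -/
lemma finrank_vertexSpace [Nonempty E] {c σ τ : ℝ} (hσ : σ ≠ 0) (h : c ^ 2 + σ * τ = 1) :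
    Module.finrank ℝ (Γ.vertexSpace c σ τ) = Γ.transitionRoots.count c := by
  rw [← (Γ.finrank_ker_pencil_and_card c).1]
  let F : (V → ℝ) →ₗ[ℝ] (E → ℝ) × (E → ℝ) :=
    { toFun := fun φ => (fun e => φ (Γ.o e), fun e => (φ (Γ.t e) - c * φ (Γ.o e)) / σ)
      map_add' := fun φ ψ => by
        ext e
        · rfl
        · simp only [Pi.add_apply, Prod.snd_add]; ring
      map_smul' := fun k φ => by
        ext e
        · rfl
        · simp only [Pi.smul_apply, Prod.smul_snd, smul_eq_mul, RingHom.id_apply]; ring }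
  have hFs : ∀ φ v, Γ.endSum (F φ).2 (τ • (F φ).1 - c • (F φ).2) v =
      σ⁻¹ * (Γ.pencil c).mulVec φ v := by
    intro φ v
    rw [pencil_mulVec, ← endSum_smul]
    congr 1 <;> ext e <;>
      simp only [F, LinearMap.coe_mk, AddHom.coe_mk, Pi.sub_apply, Pi.smul_apply, smul_eq_mul]
    · field_simp
    · field_simp
      linear_combination φ (Γ.o e) * h
  have hinj : Function.Injective F := by
    intro φ ψ hφψ
    have h1 : ∀ e, φ (Γ.o e) = ψ (Γ.o e) := fun e => congrFun (congrArg Prod.fst hφψ) e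
    have h2 : ∀ e, φ (Γ.t e) = ψ (Γ.t e) := fun e => by
      have h3 := congrFun (congrArg Prod.snd hφψ) e
      simp only [F, LinearMap.coe_mk, AddHom.coe_mk, h1 e] at h3
      rw [div_left_inj' hσ] at h3
      linarith
    ext v
    have hd : Γ.endSum (fun e => (φ - ψ) (Γ.o e) * (1 : E → ℝ) e)
        (fun e => (φ - ψ) (Γ.t e) * (1 : E → ℝ) e) v = 0 := by
      simp [h1, h2, endSum]
    rw [endSum_comp] at hd
    rcases mul_eq_zero.mp hd with h3 | h3
    · exact sub_eq_zero.mp h3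
    · exact absurd h3 (Γ.deg_pos v).ne'
  have hmap : Γ.vertexSpace c σ τ = (Γ.pencil c).mulVecLin.ker.map F := by
    ext p
    constructor
    · rintro ⟨⟨φ, hφ⟩, hs⟩
      have hp : F φ = p := by
        refine Prod.ext (funext fun e => (hφ e).1) (funext fun e => ?_)
        simp only [F, LinearMap.coe_mk, AddHom.coe_mk]
        rw [(hφ e).1, (hφ e).2]
        field_simp
        ring
      refine ⟨φ, ?_, hp⟩
      rw [SetLike.mem_coe, LinearMap.mem_ker, Matrix.mulVecLin_apply]
      ext v
      have h1 := hs v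
      rw [← hp, hFs] at h1
      exact (mul_eq_zero.mp h1).resolve_left (inv_ne_zero hσ)
    · rintro ⟨φ, hφ, rfl⟩
      rw [SetLike.mem_coe, LinearMap.mem_ker, Matrix.mulVecLin_apply] at hφ
      refine ⟨⟨φ, fun e => ⟨rfl, ?_⟩⟩, fun v => ?_⟩
      · simp only [F, LinearMap.coe_mk, AddHom.coe_mk]
        field_simp
        ring
      · rw [hFs, hφ, Pi.zero_apply, mul_zero]
  rw [hmap, ← (Submodule.equivMapOfInjective _ hinj _).finrank_eq]

/-- The quadratic form of the pencil `A - c D` is the sum over the edges of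
`2 x y - c (x² + y²)`, where `x` and `y` are the values at the two ends of the edge. -/
lemma sum_edge_eq_zero_of_mem_ker_pencil {c : ℝ} {φ : V → ℝ}
    (hφ : φ ∈ (Γ.pencil c).mulVecLin.ker) :
    ∑ e, (2 * φ (Γ.o e) * φ (Γ.t e) - c * (φ (Γ.o e) ^ 2 + φ (Γ.t e) ^ 2)) = 0 := by
  rw [LinearMap.mem_ker, Matrix.mulVecLin_apply] at hφ
  have h1 := Γ.sum_mul_endSum φ (fun e => φ (Γ.t e) - c * φ (Γ.o e))
      (fun e => φ (Γ.o e) - c * φ (Γ.t e))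
  simp_rw [← pencil_mulVec, hφ] at h1
  simp only [Pi.zero_apply, mul_zero, Finset.sum_const_zero] at h1
  rw [h1]
  exact Finset.sum_congr rfl fun e _ => by ring

lemma count_one_transitionRoots [Nonempty E] : Γ.transitionRoots.count 1 = 1 := by
  rw [← (Γ.finrank_ker_pencil_and_card 1).1, finrank_eq_one_iff']
  obtain ⟨v₀⟩ := Γ.connected.nonempty
  refine ⟨⟨1, ?_⟩, ?_, ?_⟩
  · rw [LinearMap.mem_ker, Matrix.mulVecLin_apply]
    ext v
    simp [pencil_mulVec, endSum]
  · intro h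
    have := congrFun (congrArg Subtype.val h) v₀
    simp at this
  · rintro ⟨φ, hφ⟩
    refine ⟨φ v₀, Subtype.ext (funext fun v => ?_)⟩
    have h1 := Γ.sum_edge_eq_zero_of_mem_ker_pencil hφ
    have h2 : ∑ e, (φ (Γ.o e) - φ (Γ.t e)) ^ 2 = 0 := by
      rw [← neg_eq_zero, ← h1, ← Finset.sum_neg_distrib]
      exact Finset.sum_congr rfl fun e _ => by ring
    rw [Finset.sum_eq_zero_iff_of_nonneg fun e _ => sq_nonneg _] at h2
    have : φ v₀ = φ v := Γ.eq_of_forall_edge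
      (fun e => sub_eq_zero.mp (pow_eq_zero_iff two_ne_zero |>.mp (h2 e (Finset.mem_univ e)))) v₀ v
    simp [this]

lemma ker_pencil_neg_one [Nonempty E] (hbip : ¬ Γ.graph.IsBipartite) :
    (Γ.pencil (-1)).mulVecLin.ker = ⊥ := by
  rw [eq_bot_iff]
  intro φ hφ
  have h1 := Γ.sum_edge_eq_zero_of_mem_ker_pencil hφ
  have h2 : ∑ e, (φ (Γ.o e) + φ (Γ.t e)) ^ 2 = 0 := by
    rw [← h1]
    exact Finset.sum_congr rfl fun e _ => by ring
  rw [Finset.sum_eq_zero_iff_of_nonneg fun e _ => sq_nonneg _] at h2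
  refine Γ.eq_zero_of_forall_edge_neg hbip fun e => ?_
  linarith [pow_eq_zero_iff two_ne_zero |>.mp (h2 e (Finset.mem_univ e))]

lemma ker_pencil_of_one_lt_abs [Nonempty E] (hbip : ¬ Γ.graph.IsBipartite) {c : ℝ}
    (hc : 1 < |c|) : (Γ.pencil c).mulVecLin.ker = ⊥ := by
  rw [eq_bot_iff]
  intro φ hφ
  have h1 := Γ.sum_edge_eq_zero_of_mem_ker_pencil hφ
  have key : ∀ e, φ (Γ.o e) ^ 2 + φ (Γ.t e) ^ 2 = 0 := by
    rcases lt_abs.mp hc with h | h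
    · have h2 : ∑ e, ((φ (Γ.o e) - φ (Γ.t e)) ^ 2 +
          (c - 1) * (φ (Γ.o e) ^ 2 + φ (Γ.t e) ^ 2)) = 0 := by
        rw [← neg_eq_zero, ← h1, ← Finset.sum_neg_distrib]
        exact Finset.sum_congr rfl fun e _ => by ring
      have hc' : 0 < c - 1 := by linarith
      rw [Finset.sum_eq_zero_iff_of_nonneg fun e _ => by positivity] at h2
      intro e
      have h3 := h2 e (Finset.mem_univ e)
      have h4 : 0 ≤ (c - 1) * (φ (Γ.o e) ^ 2 + φ (Γ.t e) ^ 2) := by positivity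
      have h5 : (c - 1) * (φ (Γ.o e) ^ 2 + φ (Γ.t e) ^ 2) = 0 := by
        linarith [sq_nonneg (φ (Γ.o e) - φ (Γ.t e))]
      exact (mul_eq_zero.mp h5).resolve_left hc'.ne'
    · have h2 : ∑ e, ((φ (Γ.o e) + φ (Γ.t e)) ^ 2 +
          (-c - 1) * (φ (Γ.o e) ^ 2 + φ (Γ.t e) ^ 2)) = 0 := by
        rw [← h1]
        exact Finset.sum_congr rfl fun e _ => by ring
      have hc' : 0 < -c - 1 := by linarith
      rw [Finset.sum_eq_zero_iff_of_nonneg fun e _ => by positivity] at h2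
      intro e
      have h3 := h2 e (Finset.mem_univ e)
      have h4 : 0 ≤ (-c - 1) * (φ (Γ.o e) ^ 2 + φ (Γ.t e) ^ 2) := by positivity
      have h5 : (-c - 1) * (φ (Γ.o e) ^ 2 + φ (Γ.t e) ^ 2) = 0 := by
        linarith [sq_nonneg (φ (Γ.o e) + φ (Γ.t e))]
      exact (mul_eq_zero.mp h5).resolve_left hc'.ne'
  refine Γ.eq_zero_of_forall_edge_neg hbip fun e => ?_
  have h3 : φ (Γ.o e) = 0 := by nlinarith [key e, sq_nonneg (φ (Γ.o e)), sq_nonneg (φ (Γ.t e))]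
  have h4 : φ (Γ.t e) = 0 := by nlinarith [key e, sq_nonneg (φ (Γ.o e)), sq_nonneg (φ (Γ.t e))]
  rw [h3, h4, neg_zero]

lemma count_transitionRoots_of_one_lt_abs [Nonempty E] (hbip : ¬ Γ.graph.IsBipartite) {c : ℝ}
    (hc : 1 < |c|) : Γ.transitionRoots.count c = 0 := by
  rw [← (Γ.finrank_ker_pencil_and_card c).1, Γ.ker_pencil_of_one_lt_abs hbip hc, finrank_bot]

lemma count_neg_one_transitionRoots [Nonempty E] (hbip : ¬ Γ.graph.IsBipartite) :
    Γ.transitionRoots.count (-1) = 0 := by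
  rw [← (Γ.finrank_ker_pencil_and_card (-1)).1, Γ.ker_pencil_neg_one hbip, finrank_bot]

/-- The eigenvalues of the transition matrix other than the simple eigenvalue `1`. -/
noncomputable def nontrivialRoots : Multiset ℝ := Γ.transitionRoots.erase 1

lemma transitionRoots_eq_cons [Nonempty E] :
    Γ.transitionRoots = 1 ::ₘ Γ.nontrivialRoots := by
  refine (Multiset.cons_erase ?_).symm
  rw [← Multiset.one_le_count_iff_mem, Γ.count_one_transitionRoots]

lemma card_nontrivialRoots [Nonempty E] :
    Γ.nontrivialRoots.card + 1 = Fintype.card V := by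
  rw [← (Γ.finrank_ker_pencil_and_card 1).2, transitionRoots_eq_cons, Multiset.card_cons]

lemma abs_lt_one_of_mem_nontrivialRoots [Nonempty E] (hbip : ¬ Γ.graph.IsBipartite) {c : ℝ}
    (hc : c ∈ Γ.nontrivialRoots) : |c| < 1 := by
  have hmem : 0 < Γ.transitionRoots.count c := by
    rw [Multiset.count_pos, transitionRoots_eq_cons]
    exact Multiset.mem_cons_of_mem hc
  by_contra hge
  rcases (not_lt.mp hge).lt_or_eq with h | h
  · rw [Γ.count_transitionRoots_of_one_lt_abs hbip h] at hmem
    exact hmem.false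
  · rcases (abs_eq zero_le_one).mp h.symm with rfl | rfl
    · have h1 := Γ.count_one_transitionRoots
      rw [transitionRoots_eq_cons, Multiset.count_cons_self] at h1
      have := Multiset.count_pos.mpr hc
      omega
    · rw [Γ.count_neg_one_transitionRoots hbip] at hmem
      exact hmem.false

end MetricGraph

/-! ### Solutions of the eigenvalue equation on an edge -/

/-- `c` and `s` are the fundamental solutions of `-f'' = μ f`, with `c 0 = 1`, `c' 0 = 0` and
`s 0 = 0`, `s' 0 = 1`. -/
structure IsFundamentalPair (μ : ℝ) (c s : ℝ → ℝ) : Prop where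
  hasDerivAt_cos : ∀ x, HasDerivAt c (-(μ * s x)) x
  hasDerivAt_sin : ∀ x, HasDerivAt s (c x) x
  cos_zero : c 0 = 1
  sin_zero : s 0 = 0

namespace IsFundamentalPair

variable {μ : ℝ} {c s : ℝ → ℝ}

lemma of_pos {κ : ℝ} (hκ : 0 < κ) :
    IsFundamentalPair (κ ^ 2) (fun x => Real.cos (κ * x)) (fun x => Real.sin (κ * x) / κ) where
  hasDerivAt_cos x := by
    have h := ((hasDerivAt_id x).const_mul κ).cos
    convert! h using 1
    simp only [id, mul_one]
    field_simp
  hasDerivAt_sin x := by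
    have h := (((hasDerivAt_id x).const_mul κ).sin).div_const κ
    convert! h using 1
    simp only [id, mul_one]
    field_simp
  cos_zero := by simp
  sin_zero := by simp

lemma zero : IsFundamentalPair 0 (fun _ => 1) (fun x => x) where
  hasDerivAt_cos x := by simpa using hasDerivAt_const x (1 : ℝ)
  hasDerivAt_sin x := hasDerivAt_id x
  cos_zero := rfl
  sin_zero := rfl

lemma of_neg {κ : ℝ} (hκ : 0 < κ) :
    IsFundamentalPair (-κ ^ 2) (fun x => Real.cosh (κ * x)) (fun x => Real.sinh (κ * x) / κ) where
  hasDerivAt_cos x := by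
    have h := ((hasDerivAt_id x).const_mul κ).cosh
    convert! h using 1
    simp only [id, mul_one]
    field_simp
  hasDerivAt_sin x := by
    have h := (((hasDerivAt_id x).const_mul κ).sinh).div_const κ
    convert! h using 1
    simp only [id, mul_one]
    field_simp
  cos_zero := by simp
  sin_zero := by simp

lemma sq_add (h : IsFundamentalPair μ c s) (x : ℝ) : c x ^ 2 + μ * s x ^ 2 = 1 := by
  have hd : ∀ y, HasDerivAt (fun y => c y ^ 2 + μ * s y ^ 2) 0 y := by
    intro y
    convert! ((h.hasDerivAt_cos y).pow 2).add (((h.hasDerivAt_sin y).pow 2).const_mul μ) using 1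
    push_cast
    ring
  have := is_const_of_deriv_eq_zero (fun y => (hd y).differentiableAt) (fun y => (hd y).deriv) x 0
  simpa [h.cos_zero, h.sin_zero] using this

/-- The solution of `-f'' = μ f` with `f 0 = a` and `f' 0 = b`, together with its derivative. -/
lemma hasDerivAt_comb (h : IsFundamentalPair μ c s) (a b x : ℝ) :
    HasDerivAt (fun y => a * c y + b * s y) (b * c x - μ * a * s x) x := by
  convert! ((h.hasDerivAt_cos x).const_mul a).add ((h.hasDerivAt_sin x).const_mul b) using 1
  ring

lemma hasDerivAt_comb_deriv (h : IsFundamentalPair μ c s) (a b x : ℝ) :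
    HasDerivAt (fun y => b * c y - μ * a * s y) (-(μ * (a * c x + b * s x))) x := by
  convert! ((h.hasDerivAt_cos x).const_mul b).sub ((h.hasDerivAt_sin x).const_mul (μ * a)) using 1
  ring

lemma continuous_cos (h : IsFundamentalPair μ c s) : Continuous c :=
  continuous_iff_continuousAt.mpr fun x => (h.hasDerivAt_cos x).continuousAt

lemma continuous_sin (h : IsFundamentalPair μ c s) : Continuous s :=
  continuous_iff_continuousAt.mpr fun x => (h.hasDerivAt_sin x).continuousAt

lemma continuous_comb (h : IsFundamentalPair μ c s) (a b : ℝ) :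
    Continuous fun y => a * c y + b * s y :=
  (h.continuous_cos.const_mul a).add (h.continuous_sin.const_mul b)

lemma absolutelyContinuousOnInterval_cos (h : IsFundamentalPair μ c s) (p q : ℝ) :
    AbsolutelyContinuousOnInterval c p q := by
  refine ContDiffOn.absolutelyContinuousOnInterval (ContDiff.contDiffOn ?_)
  refine contDiff_one_iff_deriv.mpr ⟨fun x => (h.hasDerivAt_cos x).differentiableAt, ?_⟩
  rw [funext fun x => (h.hasDerivAt_cos x).deriv]
  exact (h.continuous_sin.const_mul μ).neg

lemma absolutelyContinuousOnInterval_sin (h : IsFundamentalPair μ c s) (p q : ℝ) :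
    AbsolutelyContinuousOnInterval s p q := by
  refine ContDiffOn.absolutelyContinuousOnInterval (ContDiff.contDiffOn ?_)
  refine contDiff_one_iff_deriv.mpr ⟨fun x => (h.hasDerivAt_sin x).differentiableAt, ?_⟩
  rw [funext fun x => (h.hasDerivAt_sin x).deriv]
  exact h.continuous_cos

/-- Uniqueness of the solution of `-f'' = μ f` in the Carathéodory sense: `c f - s f'` and
`μ s f + c f'` are absolutely continuous with derivative zero almost everywhere. -/
lemma eq_comb (h : IsFundamentalPair μ c s) {f g : ℝ → ℝ} {l : ℝ} (hl : 0 < l)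
    (hf : AbsolutelyContinuousOnInterval f 0 l) (hg : AbsolutelyContinuousOnInterval g 0 l)
    (hfg : ∀ x ∈ Set.Icc 0 l, HasDerivWithinAt f (g x) (Set.Icc 0 l) x)
    (hgf : ∀ᵐ x ∂(volume.restrict (Set.Icc 0 l)), HasDerivAt g (-(μ * f x)) x) :
    ∀ x ∈ Set.Icc 0 l, f x = f 0 * c x + g 0 * s x ∧ g x = g 0 * c x - μ * f 0 * s x := by
  have hc := h.absolutelyContinuousOnInterval_cos 0 l
  have hs := h.absolutelyContinuousOnInterval_sin 0 l
  have hae : ∀ᵐ x, x ∈ Set.uIcc 0 l →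
      HasDerivAt f (g x) x ∧ HasDerivAt g (-(μ * f x)) x := by
    have h1 : ∀ᵐ x ∂(volume : Measure ℝ), x ≠ 0 ∧ x ≠ l :=
      (measure_eq_zero_iff_ae_notMem.mp (measure_singleton (0 : ℝ))).and
        (measure_eq_zero_iff_ae_notMem.mp (measure_singleton l))
    filter_upwards [h1, (ae_restrict_iff' measurableSet_Icc).mp hgf] with x hx hx2 hxm
    rw [Set.uIcc_of_le hl.le] at hxm
    refine ⟨(hfg x hxm).hasDerivAt (Icc_mem_nhds ?_ ?_), hx2 hxm⟩
    · exact lt_of_le_of_ne hxm.1 hx.1.symm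
    · exact lt_of_le_of_ne hxm.2 hx.2
  have hP : ∀ x ∈ Set.Icc 0 l, c x * f x - s x * g x = f 0 := by
    intro x hx
    have hac := (hc.mul hf).sub (hs.mul hg)
    obtain ⟨C, hC⟩ := hac.const_of_ae_hasDerivAt_zero (by
      filter_upwards [hae] with y hy hym
      obtain ⟨h1, h2⟩ := hy hym
      convert! ((h.hasDerivAt_cos y).mul h1).sub ((h.hasDerivAt_sin y).mul h2) using 1
      ring)
    rw [Set.uIcc_of_le hl.le] at hC
    have e1 := hC x hx
    have e2 := hC 0 (Set.left_mem_Icc.mpr hl.le)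
    simp only [Pi.sub_apply, Pi.mul_apply, h.cos_zero, h.sin_zero] at e1 e2
    linarith
  have hQ : ∀ x ∈ Set.Icc 0 l, μ * (s x * f x) + c x * g x = g 0 := by
    intro x hx
    have hac := ((hs.mul hf).const_mul μ).add (hc.mul hg)
    obtain ⟨C, hC⟩ := hac.const_of_ae_hasDerivAt_zero (by
      filter_upwards [hae] with y hy hym
      obtain ⟨h1, h2⟩ := hy hym
      convert! (((h.hasDerivAt_sin y).mul h1).const_mul μ).add ((h.hasDerivAt_cos y).mul h2)
        using 1
      ring)
    rw [Set.uIcc_of_le hl.le] at hC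
    have e1 := hC x hx
    have e2 := hC 0 (Set.left_mem_Icc.mpr hl.le)
    simp only [Pi.add_apply, Pi.mul_apply, h.cos_zero, h.sin_zero] at e1 e2
    linarith
  intro x hx
  have h1 := hP x hx
  have h2 := hQ x hx
  have h3 := h.sq_add x
  constructor
  · linear_combination c x * h1 + s x * h2 - f x * h3
  · linear_combination c x * h2 - μ * s x * h1 - g x * h3

end IsFundamentalPair

/-! ### Eigenspaces as coefficient spaces -/

namespace MetricGraph

variable {V E : Type*} (Γ : MetricGraph V E)

lemma mem_eigenspaceAt_iff (C : Submodule ℝ ((E → ℝ → ℝ) × (E → ℝ → ℝ))) (μ : ℝ) (u : Γ.L2) :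
    u ∈ (Γ.laplaceGraph C).toLinearPMap.eigenspaceAt μ ↔ (u, μ • u) ∈ Γ.laplaceGraph C := by
  rw [← (Γ.laplaceGraph C).toLinearPMap_graph_eq (fun p hp => Γ.laplaceGraph_functional C p hp),
    LinearPMap.mem_graph_iff, Submodule.toLinearPMap_graph_eq _
      (fun p hp => Γ.laplaceGraph_functional C p hp)]
  constructor
  · rintro ⟨hu, h⟩
    exact ⟨⟨u, hu⟩, rfl, h⟩
  · rintro ⟨⟨y, hy⟩, rfl, h⟩
    exact ⟨hy, h⟩

/-- The condition that a quantity on the ends of the edges coincides at every vertex, as the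
existence of a function on the vertices. -/
lemma exists_vertex_values_iff (h : E → V → ℝ) :
    (∀ v e e', Γ.Incident e v → Γ.Incident e' v → h e v = h e' v) ↔
      ∃ φ : V → ℝ, ∀ e, φ (Γ.o e) = h e (Γ.o e) ∧ φ (Γ.t e) = h e (Γ.t e) := by
  classical
  constructor
  · intro hh
    refine ⟨fun v => if hv : ∃ e, Γ.Incident e v then h hv.choose v else 0, fun e => ⟨?_, ?_⟩⟩
    · have hv : ∃ e', Γ.Incident e' (Γ.o e) := ⟨e, Or.inl rfl⟩
      beta_reduce
      rw [dif_pos hv]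
      exact hh _ _ _ hv.choose_spec (Or.inl rfl)
    · have hv : ∃ e', Γ.Incident e' (Γ.t e) := ⟨e, Or.inr rfl⟩
      beta_reduce
      rw [dif_pos hv]
      exact hh _ _ _ hv.choose_spec (Or.inr rfl)
  · rintro ⟨φ, hφ⟩ v e e' he he'
    have key : ∀ e, Γ.Incident e v → φ v = h e v := by
      rintro e (rfl | rfl)
      exacts [(hφ e).1, (hφ e).2]
    rw [← key e he, ← key e' he']

@[simp]
lemma valueAt_o (f : E → ℝ → ℝ) (e : E) : Γ.valueAt f e (Γ.o e) = f e 0 := if_pos rfl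

@[simp]
lemma valueAt_t (f : E → ℝ → ℝ) (e : E) : Γ.valueAt f e (Γ.t e) = f e (Γ.len e) :=
  if_neg (Γ.no_loop e)

@[simp]
lemma outDerivAt_o (g : E → ℝ → ℝ) (e : E) : Γ.outDerivAt g e (Γ.o e) = g e 0 := if_pos rfl

@[simp]
lemma outDerivAt_t (g : E → ℝ → ℝ) (e : E) : Γ.outDerivAt g e (Γ.t e) = -g e (Γ.len e) :=
  if_neg (Γ.no_loop e)

lemma mem_standardConditions_iff [Fintype E] (f g : E → ℝ → ℝ) :
    (f, g) ∈ Γ.standardConditions ↔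
      (∃ φ : V → ℝ, ∀ e, φ (Γ.o e) = f e 0 ∧ φ (Γ.t e) = f e (Γ.len e)) ∧
        ∀ v, Γ.endSum (fun e => g e 0) (fun e => -g e (Γ.len e)) v = 0 := by
  have h1 := Γ.exists_vertex_values_iff (Γ.valueAt f)
  simp only [valueAt_o, valueAt_t] at h1
  rw [← h1]
  have h2 := Γ.sum_incident (Γ.outDerivAt g)
  simp only [outDerivAt_o, outDerivAt_t] at h2
  simp_rw [← h2]
  exact forall_and

lemma mem_antiStandardConditions_iff [Fintype E] (f g : E → ℝ → ℝ) :
    (f, g) ∈ Γ.antiStandardConditions ↔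
      (∃ φ : V → ℝ, ∀ e, φ (Γ.o e) = g e 0 ∧ φ (Γ.t e) = -g e (Γ.len e)) ∧
        ∀ v, Γ.endSum (fun e => f e 0) (fun e => f e (Γ.len e)) v = 0 := by
  have h1 := Γ.exists_vertex_values_iff (Γ.outDerivAt g)
  simp only [outDerivAt_o, outDerivAt_t] at h1
  rw [← h1]
  have h2 := Γ.sum_incident (Γ.valueAt f)
  simp only [valueAt_o, valueAt_t] at h2
  simp_rw [← h2]
  exact forall_and

/-- A continuous function on the line as an element of `L²[0, l]`. -/
noncomputable def _root_.Continuous.toL2Icc {f : ℝ → ℝ} (hf : Continuous f) (l : ℝ) :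
    Lp ℝ 2 (volume.restrict (Set.Icc (0 : ℝ) l)) :=
  MemLp.toLp f (by
    obtain ⟨C, hC⟩ := isCompact_Icc.exists_bound_of_continuousOn hf.continuousOn
    exact MemLp.of_bound hf.aestronglyMeasurable C
      ((ae_restrict_iff' measurableSet_Icc).mpr (.of_forall hC)))

lemma _root_.Continuous.coeFn_toL2Icc {f : ℝ → ℝ} (hf : Continuous f) (l : ℝ) :
    hf.toL2Icc l =ᵐ[volume.restrict (Set.Icc (0 : ℝ) l)] f :=
  MemLp.coeFn_toLp _

section solution

variable {μ : ℝ} {c s : ℝ → ℝ} (h : IsFundamentalPair μ c s)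

/-- The element of `L²(Γ)` that is `a e * c + b e * s` on the edge `e`, as a function of the
coefficients `(a, b)`. -/
noncomputable def solution : ((E → ℝ) × (E → ℝ)) →ₗ[ℝ] Γ.L2 where
  toFun p := WithLp.toLp 2 fun e =>
    p.1 e • h.continuous_cos.toL2Icc (Γ.len e) + p.2 e • h.continuous_sin.toL2Icc (Γ.len e)
  map_add' p q := by
    ext e : 1
    simp only [Prod.fst_add, Prod.snd_add, Pi.add_apply, PiLp.add_apply]
    module
  map_smul' k p := by
    ext e : 1
    simp only [Prod.smul_fst, Prod.smul_snd, Pi.smul_apply, PiLp.smul_apply, smul_eq_mul,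
      RingHom.id_apply]
    module

lemma coeFn_solution (p : (E → ℝ) × (E → ℝ)) (e : E) :
    ∀ᵐ x ∂(volume.restrict (Set.Icc 0 (Γ.len e))),
      Γ.solution h p e x = p.1 e * c x + p.2 e * s x := by
  filter_upwards [h.continuous_cos.coeFn_toL2Icc (Γ.len e),
    h.continuous_sin.coeFn_toL2Icc (Γ.len e),
    Lp.coeFn_smul (p.1 e) (h.continuous_cos.toL2Icc (Γ.len e)),
    Lp.coeFn_smul (p.2 e) (h.continuous_sin.toL2Icc (Γ.len e)),
    Lp.coeFn_add (p.1 e • h.continuous_cos.toL2Icc (Γ.len e))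
      (p.2 e • h.continuous_sin.toL2Icc (Γ.len e))] with x h1 h2 h3 h4 h5
  change (p.1 e • h.continuous_cos.toL2Icc (Γ.len e) +
    p.2 e • h.continuous_sin.toL2Icc (Γ.len e) : Lp ℝ 2 _) x = _
  rw [h5, Pi.add_apply, h3, h4, Pi.smul_apply, Pi.smul_apply, h1, h2, smul_eq_mul, smul_eq_mul]

lemma solution_injective : Function.Injective (Γ.solution h) := by
  rw [injective_iff_map_eq_zero]
  intro p hp
  have key : ∀ e, p.1 e = 0 ∧ p.2 e = 0 := by
    intro e
    have h1 : Set.EqOn (fun x => p.1 e * c x + p.2 e * s x) 0 (Set.Icc 0 (Γ.len e)) := by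
      refine Measure.eqOn_Icc_of_ae_eq volume (Γ.len_pos e).ne ?_
        (h.continuous_comb _ _).continuousOn continuousOn_const
      filter_upwards [Γ.coeFn_solution h p e,
        Lp.coeFn_zero ℝ 2 (volume.restrict (Set.Icc (0 : ℝ) (Γ.len e)))] with x h2 h3
      rw [← h2, hp]
      exact h3
    have h0 : (0 : ℝ) ∈ Set.Icc 0 (Γ.len e) := Set.left_mem_Icc.mpr (Γ.len_pos e).le
    have h2 : HasDerivWithinAt (fun x => p.1 e * c x + p.2 e * s x) 0 (Set.Icc 0 (Γ.len e)) 0 :=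
      (hasDerivWithinAt_const (0 : ℝ) _ (0 : ℝ)).congr (fun y hy => h1 hy) (h1 h0)
    have h3 := (uniqueDiffOn_Icc (Γ.len_pos e) 0 h0).eq_deriv _
      (h.hasDerivAt_comb (p.1 e) (p.2 e) 0).hasDerivWithinAt h2
    have h4 := h1 h0
    simp only [h.cos_zero, h.sin_zero, mul_one, mul_zero, add_zero, sub_zero] at h3 h4
    exact ⟨h4, h3⟩
  exact Prod.ext (funext fun e => (key e).1) (funext fun e => (key e).2)

/-- If the vertex conditions `C` amount to `(a, b) ∈ M` for the functions `a e * c + b e * s`, then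
these functions, with `(a, b) ∈ M`, make up the eigenspace. -/
lemma eigenspaceAt_eq_map {C : Submodule ℝ ((E → ℝ → ℝ) × (E → ℝ → ℝ))}
    {M : Submodule ℝ ((E → ℝ) × (E → ℝ))}
    (hM : ∀ p f g, (∀ e, f e 0 = p.1 e ∧ g e 0 = p.2 e ∧
        f e (Γ.len e) = p.1 e * c (Γ.len e) + p.2 e * s (Γ.len e) ∧
        g e (Γ.len e) = p.2 e * c (Γ.len e) - μ * p.1 e * s (Γ.len e)) →
      ((f, g) ∈ C ↔ p ∈ M)) :
    (Γ.laplaceGraph C).toLinearPMap.eigenspaceAt μ = M.map (Γ.solution h) := by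
  have hsmul : ∀ (u : Γ.L2) e, ∀ᵐ x ∂(volume.restrict (Set.Icc 0 (Γ.len e))),
      (μ • u) e x = μ * u e x := fun u e => by
    filter_upwards [Lp.coeFn_smul μ (u e)] with x h3
    have h4 : (μ • u) e x = (μ • u e : Lp ℝ 2 _) x := rfl
    rw [h4, h3]
    rfl
  ext u
  rw [mem_eigenspaceAt_iff]
  constructor
  · rintro ⟨f, g, hC, hmax⟩
    have heq : ∀ e, ∀ x ∈ Set.Icc 0 (Γ.len e), f e x = f e 0 * c x + g e 0 * s x ∧
        g e x = g e 0 * c x - μ * f e 0 * s x := fun e => by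
      refine h.eq_comb (Γ.len_pos e) (hmax.ac e) (hmax.ac_deriv e) (hmax.hasDeriv e) ?_
      filter_upwards [hmax.rep e, hmax.eqn e, hsmul u e] with x h1 h2 h3
      have h2' : HasDerivAt (g e) (-((μ • u) e x)) x := h2
      rw [h3] at h2'
      have h1' : u e x = f e x := h1
      rwa [h1'] at h2'
    refine ⟨(fun e => f e 0, fun e => g e 0), ?_, ?_⟩
    · refine (hM _ f g fun e => ?_).mp hC
      have := heq e _ (Set.right_mem_Icc.mpr (Γ.len_pos e).le)
      exact ⟨rfl, rfl, this.1, this.2⟩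
    · ext e : 1
      refine Lp.ext ?_
      filter_upwards [Γ.coeFn_solution h (fun e => f e 0, fun e => g e 0) e, hmax.rep e,
        ae_restrict_mem measurableSet_Icc] with x h1 h2 hx
      rw [h1]
      exact ((heq e x hx).1.symm.trans h2.symm)
  · rintro ⟨p, hp, rfl⟩
    refine ⟨fun e x => p.1 e * c x + p.2 e * s x, fun e x => p.2 e * c x - μ * p.1 e * s x,
      (hM p _ _ fun e => ?_).mpr hp, ?_, ?_, ?_, ?_, ?_⟩
    · simp [h.cos_zero, h.sin_zero]
    · exact fun e => ((h.absolutelyContinuousOnInterval_cos _ _).const_mul _).add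
        ((h.absolutelyContinuousOnInterval_sin _ _).const_mul _)
    · exact fun e => ((h.absolutelyContinuousOnInterval_cos _ _).const_mul _).sub
        ((h.absolutelyContinuousOnInterval_sin _ _).const_mul _)
    · exact fun e x _ => (h.hasDerivAt_comb _ _ x).hasDerivWithinAt
    · exact fun e => Γ.coeFn_solution h p e
    · intro e
      filter_upwards [Γ.coeFn_solution h p e, hsmul (Γ.solution h p) e] with x h1 h2
      have h3 := h.hasDerivAt_comb_deriv (p.1 e) (p.2 e) x
      rw [← h1, ← h2] at h3
      exact h3

end solution

section rank

variable [Fintype E] {μ : ℝ} {c s : ℝ → ℝ}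

lemma rank_eigenspaceAt_standardLaplacian (h : IsFundamentalPair μ c s) {l : ℝ}
    (hl : ∀ e, Γ.len e = l) :
    Module.rank ℝ (Γ.standardLaplacian.eigenspaceAt μ) =
      Module.finrank ℝ (Γ.vertexSpace (c l) (s l) (μ * s l)) := by
  have hM := Γ.eigenspaceAt_eq_map h (C := Γ.standardConditions)
    (M := Γ.vertexSpace (c l) (s l) (μ * s l)) (by
      intro p f g hfg
      simp only [hl] at hfg
      rw [mem_standardConditions_iff]
      refine and_congr (exists_congr fun φ => forall_congr' fun e => ?_)
        (forall_congr' fun v => ?_)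
      · rw [hl, (hfg e).1, (hfg e).2.2.1]
        ring_nf
      · have h1 : (fun e => g e 0) = p.2 := funext fun e => (hfg e).2.1
        have h2 : (fun e => -g e (Γ.len e)) = (μ * s l) • p.1 - c l • p.2 := funext fun e => by
          rw [hl, (hfg e).2.2.2]
          simp only [Pi.sub_apply, Pi.smul_apply, smul_eq_mul]
          ring
        rw [h1, h2])
  rw [standardLaplacian, hM, ← (Submodule.equivMapOfInjective _ (Γ.solution_injective h) _).rank_eq,
    Module.finrank_eq_rank]

/-- For anti-standard conditions the outgoing derivatives take the role of the values, so that the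
coefficients `a` and `b` are interchanged. -/
lemma rank_eigenspaceAt_antiStandardLaplacian (h : IsFundamentalPair μ c s) {l : ℝ}
    (hl : ∀ e, Γ.len e = l) :
    Module.rank ℝ (Γ.antiStandardLaplacian.eigenspaceAt μ) =
      Module.finrank ℝ (Γ.vertexSpace (-c l) (μ * s l) (s l)) := by
  let T := LinearEquiv.prodComm ℝ (E → ℝ) (E → ℝ)
  have hM := Γ.eigenspaceAt_eq_map h (C := Γ.antiStandardConditions)
    (M := (Γ.vertexSpace (-c l) (μ * s l) (s l)).map T.toLinearMap) (by
      intro p f g hfg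
      simp only [hl] at hfg
      have hT : p ∈ (Γ.vertexSpace (-c l) (μ * s l) (s l)).map T.toLinearMap ↔
          (p.2, p.1) ∈ Γ.vertexSpace (-c l) (μ * s l) (s l) := by
        constructor
        · rintro ⟨q, hq, rfl⟩
          exact hq
        · exact fun hq => ⟨_, hq, rfl⟩
      rw [mem_antiStandardConditions_iff, hT]
      refine and_congr (exists_congr fun φ => forall_congr' fun e => ?_)
        (forall_congr' fun v => ?_)
      · rw [hl, (hfg e).2.1, (hfg e).2.2.2]
        ring_nf
      · have h1 : (fun e => f e 0) = p.1 := funext fun e => (hfg e).1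
        have h2 : (fun e => f e (Γ.len e)) = s l • p.2 - (-c l) • p.1 := funext fun e => by
          rw [hl, (hfg e).2.2.1]
          simp only [Pi.sub_apply, Pi.smul_apply, smul_eq_mul]
          ring
        rw [h1, h2])
  rw [antiStandardLaplacian, hM,
    ← (Submodule.equivMapOfInjective _ (Γ.solution_injective h) _).rank_eq,
    ← (Submodule.equivMapOfInjective _ T.injective _).rank_eq, Module.finrank_eq_rank]

end rank

end MetricGraph

/-! ### Counting functions of trigonometric spectra -/

lemma Cardinal.sum_natCast_eq.{u} {ι : Type} (d : ι → ℕ) (A : Finset ι) (h : ∀ i, i ∉ A → d i = 0) :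
    Cardinal.sum (fun i => (d i : Cardinal.{u})) = ((∑ i ∈ A, d i : ℕ) : Cardinal.{u}) := by
  have h1 : (fun i => (d i : Cardinal.{u})) = fun i => Cardinal.mk (ULift.{u} (Fin (d i))) := by
    ext i; simp
  have hbij : Function.Bijective
      (fun x : Σ i : A, ULift.{u} (Fin (d i)) => (⟨x.1, x.2⟩ : Σ i : ι, ULift.{u} (Fin (d i)))) := by
    constructor
    · rintro ⟨⟨i, hi⟩, x⟩ ⟨⟨j, hj⟩, y⟩ hxy
      simp only [Sigma.mk.injEq] at hxy
      obtain ⟨rfl, hxy⟩ := hxy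
      rw [heq_eq_eq] at hxy
      rw [hxy]
    · rintro ⟨i, x⟩
      by_cases hi : i ∈ A
      · exact ⟨⟨⟨i, hi⟩, x⟩, rfl⟩
      · have h2 := x.down.isLt
        have h3 := h i hi
        omega
  rw [h1, ← Cardinal.mk_sigma, ← Cardinal.mk_congr (Equiv.ofBijective _ hbij), Cardinal.mk_fintype,
    Fintype.card_sigma]
  simp [Finset.sum_attach A d]

lemma LinearPMap.eigenvalueCount_mono {H : Type*} [AddCommGroup H] [Module ℝ H]
    (T : H →ₗ.[ℝ] H) : Monotone T.eigenvalueCount := by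
  intro s s' hs
  refine Cardinal.mk_le_of_injective
    (f := Sigma.map (Set.inclusion (Set.Iic_subset_Iic.mpr hs)) fun _ => id) ?_
  exact (Set.inclusion_injective _).sigma_map fun _ => Function.injective_id

lemma Multiset.sum_map_ite_one_zero {α : Type*} (p : α → Prop) [DecidablePred p]
    (R : Multiset α) : (R.map fun c => if p c then 1 else 0).sum = (R.filter p).card := by
  induction R using Multiset.induction_on with
  | empty => simp
  | cons a R ih => by_cases h : p a <;> simp [h, ih, add_comm]

/-- The points of `[0, π q + φ]` at which the cosine takes the value `c`: there is exactly one in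
each interval `(π i, π (i + 1))`. -/
noncomputable def cosFiber (q : ℕ) (φ c : ℝ) : Finset ℝ :=
  (Finset.range (if Real.cos φ ≤ (-1) ^ q * c then q + 1 else q)).image
    fun i : ℕ => Real.arccos ((-1) ^ i * c) + i * Real.pi

section cosFiber

variable {q : ℕ} {φ c : ℝ}

lemma abs_neg_one_pow_mul (i : ℕ) (c : ℝ) : |(-1) ^ i * c| = |c| := by
  simp [abs_mul]

lemma cos_arccos_neg_one_pow_mul (hc : |c| < 1) (i : ℕ) :
    Real.cos (Real.arccos ((-1) ^ i * c) + i * Real.pi) = c := by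
  have h := abs_lt.mp ((abs_neg_one_pow_mul i c).trans_lt hc)
  rw [Real.cos_add_nat_mul_pi, Real.cos_arccos h.1.le h.2.le, ← mul_assoc, ← mul_pow]
  norm_num

lemma arccos_neg_one_pow_mul_mem (hc : |c| < 1) (i : ℕ) :
    Real.arccos ((-1) ^ i * c) ∈ Set.Ioo 0 Real.pi := by
  have h := abs_lt.mp ((abs_neg_one_pow_mul i c).trans_lt hc)
  exact ⟨Real.arccos_pos.mpr h.2, Real.arccos_lt_pi.mpr h.1⟩

/-- The numbers `α + i π` with `0 ≤ α < π` are ordered lexicographically by `(i, α)`. -/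
lemma add_mul_pi_le_iff {α : ℝ} (hα : α ∈ Set.Ico 0 Real.pi) (hφ : φ ∈ Set.Ico 0 Real.pi) (i q : ℕ) :
    α + i * Real.pi ≤ φ + q * Real.pi ↔ i < q ∨ i = q ∧ α ≤ φ := by
  have hpi := Real.pi_pos
  constructor
  · intro h
    rcases lt_trichotomy i q with h1 | rfl | h1
    · exact Or.inl h1
    · exact Or.inr ⟨rfl, by linarith⟩
    · have h2 : (q : ℝ) + 1 ≤ i := by exact_mod_cast h1
      nlinarith [hα.1, hφ.2]
  · rintro (h1 | ⟨rfl, h1⟩)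
    · have h2 : (i : ℝ) + 1 ≤ q := by exact_mod_cast h1
      nlinarith [hα.2, hφ.1]
    · linarith

lemma add_mul_pi_inj {α β : ℝ} (hα : α ∈ Set.Ico 0 Real.pi) (hβ : β ∈ Set.Ico 0 Real.pi) {i j : ℕ}
    (h : α + i * Real.pi = β + j * Real.pi) : i = j := by
  have h1 := (add_mul_pi_le_iff hα hβ i j).mp h.le
  have h2 := (add_mul_pi_le_iff hβ hα j i).mp h.ge
  omega

lemma exists_add_mul_pi {x : ℝ} (hx : 0 ≤ x) :
    ∃ (i : ℕ) (α : ℝ), α ∈ Set.Ico 0 Real.pi ∧ x = α + i * Real.pi := by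
  have hpi := Real.pi_pos
  refine ⟨⌊x / Real.pi⌋₊, x - ⌊x / Real.pi⌋₊ * Real.pi, ⟨?_, ?_⟩, by ring⟩
  · have := Nat.floor_le (div_nonneg hx hpi.le)
    rw [le_div_iff₀ hpi] at this
    linarith
  · have := Nat.lt_floor_add_one (x / Real.pi)
    rw [div_lt_iff₀ hpi] at this
    linarith

lemma neg_or_exists_sq_eq {l : ℝ} (hl0 : 0 < l) (s : ℝ) :
    s < 0 ∨ ∃ (q : ℕ) (φ : ℝ), φ ∈ Set.Ico 0 Real.pi ∧ s = ((φ + q * Real.pi) / l) ^ 2 := by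
  rcases lt_or_ge s 0 with h | h
  · exact Or.inl h
  · obtain ⟨q, φ, hφ, hx⟩ := exists_add_mul_pi (x := l * √s) (by positivity)
    exact Or.inr ⟨q, φ, hφ, by rw [← hx, mul_div_cancel_left₀ _ hl0.ne', Real.sq_sqrt h]⟩

lemma arccos_le_iff_cos_le {y : ℝ} (hy : |y| < 1) (hφ : φ ∈ Set.Ico 0 Real.pi) :
    Real.arccos y ≤ φ ↔ Real.cos φ ≤ y := by
  have h := abs_lt.mp hy
  constructor
  · intro h1
    have := Real.cos_le_cos_of_nonneg_of_le_pi (Real.arccos_nonneg y) hφ.2.le h1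
    rwa [Real.cos_arccos h.1.le h.2.le] at this
  · intro h1
    have := Real.arccos_le_arccos h1
    rwa [Real.arccos_cos hφ.1 hφ.2.le] at this

lemma mem_cosFiber (hc : |c| < 1) (hφ : φ ∈ Set.Ico 0 Real.pi) {x : ℝ} :
    x ∈ cosFiber q φ c ↔ 0 ≤ x ∧ x ≤ φ + q * Real.pi ∧ Real.cos x = c := by
  have hIco := fun i => Set.Ioo_subset_Ico_self (arccos_neg_one_pow_mul_mem hc i)
  have hran : ∀ i : ℕ, i < (if Real.cos φ ≤ (-1) ^ q * c then q + 1 else q) ↔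
      Real.arccos ((-1) ^ i * c) + i * Real.pi ≤ φ + q * Real.pi := by
    intro i
    have h1 := arccos_le_iff_cos_le ((abs_neg_one_pow_mul q c).trans_lt hc) hφ
    rw [add_mul_pi_le_iff (hIco i) hφ]
    split_ifs with h
    · rw [Nat.lt_succ_iff_lt_or_eq]
      refine or_congr_right ⟨?_, fun h2 => h2.1⟩
      rintro rfl
      exact ⟨rfl, h1.mpr h⟩
    · refine ⟨Or.inl, ?_⟩
      rintro (h2 | ⟨rfl, h2⟩)
      exacts [h2, absurd (h1.mp h2) h]
  unfold cosFiber
  simp only [Finset.mem_image, Finset.mem_range, hran]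
  constructor
  · rintro ⟨i, hi, rfl⟩
    refine ⟨?_, hi, cos_arccos_neg_one_pow_mul hc i⟩
    have := (hIco i).1
    have := Real.pi_pos
    positivity
  · rintro ⟨hx, hxle, hcos⟩
    obtain ⟨i, α, hα, rfl⟩ := exists_add_mul_pi hx
    have h1 : Real.arccos ((-1) ^ i * c) = α := by
      rw [← hcos, Real.cos_add_nat_mul_pi, ← mul_assoc, ← mul_pow]
      norm_num
      exact Real.arccos_cos hα.1 hα.2.le
    exact ⟨i, by rwa [h1], by rw [h1]⟩

lemma card_cosFiber (hc : |c| < 1) :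
    (cosFiber q φ c).card = q + if Real.cos φ ≤ (-1) ^ q * c then 1 else 0 := by
  unfold cosFiber
  rw [Finset.card_image_of_injective, Finset.card_range]
  · split_ifs <;> rfl
  · intro i j hij
    exact add_mul_pi_inj (Set.Ioo_subset_Ico_self (arccos_neg_one_pow_mul_mem hc i))
      (Set.Ioo_subset_Ico_self (arccos_neg_one_pow_mul_mem hc j)) hij

end cosFiber

/-- The spectrum of `T` consists of the numbers `(θ / l)²`, `θ ≥ 0`, where `cos θ = c` with `c` in
the multiset `R` of numbers in `(-1, 1)`, or `θ = π i` with the multiplicity `w i`. -/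
structure LinearPMap.IsTrigSpectrum {H : Type*} [AddCommGroup H] [Module ℝ H] (T : H →ₗ.[ℝ] H)
    (l : ℝ) (R : Multiset ℝ) (w : ℕ → ℕ) : Prop where
  len_pos : 0 < l
  abs_lt_one : ∀ c ∈ R, |c| < 1
  rank_of_neg : ∀ μ < 0, Module.rank ℝ (T.eigenspaceAt μ) = 0
  rank_of_sin_ne_zero : ∀ θ, 0 ≤ θ → Real.sin θ ≠ 0 →
    Module.rank ℝ (T.eigenspaceAt ((θ / l) ^ 2)) = R.count (Real.cos θ)
  rank_nat_mul_pi : ∀ i : ℕ, Module.rank ℝ (T.eigenspaceAt ((i * Real.pi / l) ^ 2)) = w i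

namespace LinearPMap.IsTrigSpectrum

variable {H : Type*} [AddCommGroup H] [Module ℝ H] {T : H →ₗ.[ℝ] H} {l : ℝ} {R : Multiset ℝ}
  {w : ℕ → ℕ} (h : T.IsTrigSpectrum l R w)

include h

lemma eigenvalueCount_of_neg {s : ℝ} (hs : s < 0) : T.eigenvalueCount s = 0 := by
  have h1 : (fun μ : Set.Iic s => Module.rank ℝ (T.eigenspaceAt μ)) = fun _ => ((0 : ℕ) : Cardinal) :=
    funext fun μ => by rw [h.rank_of_neg μ (lt_of_le_of_lt μ.2 hs), Nat.cast_zero]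
  unfold LinearPMap.eigenvalueCount
  rw [h1, Cardinal.sum_natCast_eq (fun _ => 0) ∅ (fun _ _ => rfl)]
  simp

lemma rank_eq {q : ℕ} {φ : ℝ} (hφ : φ ∈ Set.Ico 0 Real.pi) {x : ℝ} (hx : 0 ≤ x)
    (hxle : x ≤ φ + q * Real.pi) :
    Module.rank ℝ (T.eigenspaceAt ((x / l) ^ 2)) =
      ((R.count (Real.cos x) + ∑ i ∈ Finset.range (q + 1), if x = i * Real.pi then w i else 0 : ℕ) :
        Cardinal) := by
  have hpi := Real.pi_pos
  by_cases hsin : Real.sin x = 0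
  · obtain ⟨i, α, hα, hxi⟩ := exists_add_mul_pi hx
    have hα0 : α = 0 := by
      rw [hxi, Real.sin_add_nat_mul_pi] at hsin
      have h1 : Real.sin α = 0 := by simpa using hsin
      by_contra hne
      exact (Real.sin_pos_of_pos_of_lt_pi (lt_of_le_of_ne hα.1 (Ne.symm hne)) hα.2).ne' h1
    rw [hα0, zero_add] at hxi
    have hiq : i < q + 1 := by
      have h2 : (0 : ℝ) + i * Real.pi ≤ φ + q * Real.pi := by rw [zero_add, ← hxi]; exact hxle
      have := (add_mul_pi_le_iff ⟨le_rfl, hpi⟩ hφ i q).mp h2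
      omega
    have hcount : R.count (Real.cos x) = 0 := by
      rw [Multiset.count_eq_zero]
      intro hmem
      have h1 := h.abs_lt_one _ hmem
      have h2 := Real.sin_sq_add_cos_sq x
      rw [hsin] at h2
      have h3 : |Real.cos x| ^ 2 = 1 := by rw [sq_abs]; linarith
      nlinarith [abs_nonneg (Real.cos x)]
    rw [hcount, zero_add, Finset.sum_eq_single i]
    · rw [if_pos hxi, hxi, h.rank_nat_mul_pi]
    · intro j _ hji
      refine if_neg fun hxj => hji ?_
      rw [hxi] at hxj
      exact_mod_cast (mul_right_cancel₀ hpi.ne' hxj).symm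
    · intro hi
      exact absurd (Finset.mem_range.mpr hiq) hi
  · rw [h.rank_of_sin_ne_zero x hx hsin, Finset.sum_eq_zero, add_zero]
    intro i _
    refine if_neg ?_
    rintro rfl
    exact hsin (Real.sin_nat_mul_pi i)

/-- The counting function of a trigonometric spectrum at `θ = φ + q π`: each of the first `q`
intervals of length `π` contributes `card R` eigenvalues in its interior. -/
theorem eigenvalueCount_eq (q : ℕ) {φ : ℝ} (hφ : φ ∈ Set.Ico 0 Real.pi) :
    T.eigenvalueCount (((φ + q * Real.pi) / l) ^ 2) =
      ((∑ i ∈ Finset.range (q + 1), w i + (q * R.card +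
        (R.filter fun c => Real.cos φ ≤ (-1) ^ q * c).card) : ℕ) : Cardinal) := by
  have hpi := Real.pi_pos
  have hl := h.len_pos
  set θ := φ + q * Real.pi with hθ
  have hθ0 : 0 ≤ θ := by have := hφ.1; positivity
  set d : ℝ → ℕ := fun x => R.count (Real.cos x) +
    ∑ i ∈ Finset.range (q + 1), if x = i * Real.pi then w i else 0 with hd
  -- all points of `[0, θ]` that carry an eigenvalue
  set S : Finset ℝ := (Finset.range (q + 1)).image (fun i : ℕ => (i : ℝ) * Real.pi) ∪
    R.toFinset.biUnion fun c => cosFiber q φ c with hS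
  have hSmem : ∀ x ∈ S, 0 ≤ x ∧ x ≤ θ := by
    intro x hx
    rw [hS, Finset.mem_union, Finset.mem_image, Finset.mem_biUnion] at hx
    rcases hx with ⟨i, hi, rfl⟩ | ⟨c, hc, hx⟩
    · refine ⟨by positivity, ?_⟩
      have h1 : (i : ℝ) ≤ q := by
        exact_mod_cast Nat.lt_succ_iff.mp (Finset.mem_range.mp hi)
      have h2 := hφ.1
      nlinarith
    · rw [mem_cosFiber (h.abs_lt_one c (Multiset.mem_toFinset.mp hc)) hφ] at hx
      exact ⟨hx.1, hx.2.1⟩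
  have hSd : ∀ x, 0 ≤ x → x ≤ θ → x ∉ S → d x = 0 := by
    intro x hx hxle hxS
    rw [hS, Finset.mem_union, not_or, Finset.mem_image, Finset.mem_biUnion] at hxS
    have h1 : R.count (Real.cos x) = 0 := by
      rw [Multiset.count_eq_zero]
      intro hmem
      exact hxS.2 ⟨_, Multiset.mem_toFinset.mpr hmem,
        (mem_cosFiber (h.abs_lt_one _ hmem) hφ).mpr ⟨hx, hxle, rfl⟩⟩
    rw [hd]
    simp only [h1, zero_add]
    refine Finset.sum_eq_zero fun i hi => if_neg ?_
    rintro rfl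
    exact hxS.1 ⟨i, hi, rfl⟩
  have hsq : ∀ x ∈ S, (x / l) ^ 2 ∈ Set.Iic ((θ / l) ^ 2) := by
    intro x hx
    have h1 := hSmem x hx
    rw [Set.mem_Iic]
    have : 0 ≤ x / l := div_nonneg h1.1 hl.le
    gcongr
    exact h1.2
  have hinj : Function.Injective
      (fun x : S => (⟨(x.1 / l) ^ 2, hsq x.1 x.2⟩ : Set.Iic ((θ / l) ^ 2))) := by
    rintro ⟨x, hx⟩ ⟨y, hy⟩ hxy
    have h1 : (x / l) ^ 2 = (y / l) ^ 2 := congrArg Subtype.val hxy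
    rw [sq_eq_sq₀ (div_nonneg (hSmem x hx).1 hl.le) (div_nonneg (hSmem y hy).1 hl.le),
      div_left_inj' hl.ne'] at h1
    exact Subtype.ext h1
  -- the multiplicities as a function of the eigenvalue
  set D : Set.Iic ((θ / l) ^ 2) → ℕ := fun μ => if μ.1 < 0 then 0 else d (l * √μ.1) with hD
  have hroot : ∀ μ : Set.Iic ((θ / l) ^ 2), ¬ μ.1 < 0 →
      0 ≤ l * √μ.1 ∧ l * √μ.1 ≤ θ ∧ (l * √μ.1 / l) ^ 2 = μ.1 := by
    intro μ hμ
    refine ⟨by positivity, ?_, ?_⟩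
    · have h1 : √μ.1 ≤ θ / l := Real.sqrt_le_iff.mpr ⟨div_nonneg hθ0 hl.le, μ.2⟩
      rw [le_div_iff₀ hl] at h1
      linarith
    · rw [mul_div_cancel_left₀ _ hl.ne', Real.sq_sqrt (not_lt.mp hμ)]
  have hrank : (fun μ : Set.Iic ((θ / l) ^ 2) => Module.rank ℝ (T.eigenspaceAt μ)) =
      fun μ => ((D μ : ℕ) : Cardinal) := by
    ext μ
    rw [hD]
    by_cases hμ : μ.1 < 0
    · simp only [hμ, if_true, Nat.cast_zero]
      exact h.rank_of_neg _ hμ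
    · obtain ⟨h1, h2, h3⟩ := hroot μ hμ
      simp only [hμ, if_false]
      rw [← h.rank_eq hφ h1 h2, h3]
  have hDS : ∀ x (hx : x ∈ S), D ⟨(x / l) ^ 2, hsq x hx⟩ = d x := by
    intro x hx
    have h1 : ¬ (x / l) ^ 2 < 0 := not_lt.mpr (sq_nonneg _)
    simp only [hD, h1, if_false]
    rw [Real.sqrt_sq (div_nonneg (hSmem x hx).1 hl.le), mul_div_cancel₀ _ hl.ne']
  have hcard : T.eigenvalueCount ((θ / l) ^ 2) = ((∑ x ∈ S, d x : ℕ) : Cardinal) := by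
    unfold LinearPMap.eigenvalueCount
    rw [hrank, Cardinal.sum_natCast_eq D (Finset.univ.image
      (fun x : S => (⟨(x.1 / l) ^ 2, hsq x.1 x.2⟩ : Set.Iic ((θ / l) ^ 2))))]
    · rw [Finset.sum_image hinj.injOn]
      congr 1
      rw [← Finset.sum_coe_sort S d]
      exact Finset.sum_congr rfl fun x _ => hDS x.1 x.2
    · intro μ hμ
      by_cases hneg : μ.1 < 0
      · simp only [hD, hneg, if_true]
      · obtain ⟨h1, h2, h3⟩ := hroot μ hneg
        simp only [hD, hneg, if_false]
        refine hSd _ h1 h2 fun hmem => hμ ?_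
        rw [Finset.mem_image]
        exact ⟨⟨_, hmem⟩, Finset.mem_univ _, Subtype.ext h3⟩
  rw [hcard]
  congr 1
  rw [hd, Finset.sum_add_distrib, add_comm]
  congr 1
  · rw [Finset.sum_comm]
    refine Finset.sum_congr rfl fun i hi => ?_
    rw [Finset.sum_ite_eq' S, if_pos]
    exact Finset.mem_union_left _ (Finset.mem_image_of_mem _ hi)
  · have h1 : ∀ x, R.count (Real.cos x) =
        ∑ c ∈ R.toFinset, if Real.cos x = c then R.count c else 0 := by
      intro x
      rw [Finset.sum_ite_eq]
      split_ifs with hmem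
      · rfl
      · exact Multiset.count_eq_zero.mpr fun h2 => hmem (Multiset.mem_toFinset.mpr h2)
    simp_rw [h1]
    rw [Finset.sum_comm]
    have h2 : ∀ c ∈ R.toFinset, (∑ x ∈ S, if Real.cos x = c then R.count c else 0) =
        R.count c • (q + if Real.cos φ ≤ (-1) ^ q * c then 1 else 0) := by
      intro c hc
      have hc1 := h.abs_lt_one c (Multiset.mem_toFinset.mp hc)
      rw [← Finset.sum_filter, Finset.sum_const, ← card_cosFiber hc1, smul_eq_mul, smul_eq_mul,
        mul_comm]
      congr 2
      ext x
      rw [Finset.mem_filter]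
      constructor
      · rintro ⟨hx, hcos⟩
        exact (mem_cosFiber hc1 hφ).mpr ⟨(hSmem x hx).1, (hSmem x hx).2, hcos⟩
      · intro hx
        exact ⟨Finset.mem_union_right _ (Finset.mem_biUnion.mpr ⟨c, hc, hx⟩),
          ((mem_cosFiber hc1 hφ).mp hx).2.2⟩
    rw [Finset.sum_congr rfl h2, ← Finset.sum_multiset_map_count, Multiset.sum_map_add,
      Multiset.map_const', Multiset.sum_replicate, smul_eq_mul, mul_comm]
    congr 1
    exact R.sum_map_ite_one_zero _

lemma le_eigenvalueCount (hR : 0 < R.card) (k : ℕ) :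
    (k : Cardinal) ≤ T.eigenvalueCount (((0 + k * Real.pi) / l) ^ 2) := by
  rw [h.eigenvalueCount_eq k ⟨le_rfl, Real.pi_pos⟩, Nat.cast_le]
  have := Nat.le_mul_of_pos_right k hR
  omega

/-- The counting function is continuous from the right. -/
lemma exists_gt_eigenvalueCount_eq (s : ℝ) :
    ∃ s' > s, T.eigenvalueCount s' = T.eigenvalueCount s := by
  have hl := h.len_pos
  rcases neg_or_exists_sq_eq hl s with hs | ⟨q, φ, hφ, rfl⟩
  · refine ⟨s / 2, by linarith, ?_⟩
    rw [h.eigenvalueCount_of_neg hs, h.eigenvalueCount_of_neg (by linarith)]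
  · have hev : ∀ᶠ φ' in nhdsWithin φ (Set.Ioi φ), ∀ c ∈ R.toFinset,
        (-1) ^ q * c < Real.cos φ → (-1) ^ q * c < Real.cos φ' := by
      rw [Filter.eventually_all_finset]
      intro c _
      by_cases hc : (-1) ^ q * c < Real.cos φ
      · filter_upwards [nhdsWithin_le_nhds
          (Real.continuous_cos.continuousAt.eventually (lt_mem_nhds hc))] with φ' h1 _ using h1
      · exact .of_forall fun _ h1 => absurd h1 hc
    obtain ⟨φ', ⟨hφ', hlt⟩, hlt'⟩ := ((hev.and (nhdsWithin_le_nhds (gt_mem_nhds hφ.2))).and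
      self_mem_nhdsWithin).exists
    replace hlt' : φ < φ' := hlt'
    refine ⟨((φ' + q * Real.pi) / l) ^ 2, ?_, ?_⟩
    · have h1 : 0 ≤ (φ + q * Real.pi) / l := by
        have := hφ.1
        have := Real.pi_pos
        positivity
      have h2 : (φ + q * Real.pi) / l < (φ' + q * Real.pi) / l := by gcongr
      exact pow_lt_pow_left₀ h2 h1 two_ne_zero
    · rw [h.eigenvalueCount_eq q hφ, h.eigenvalueCount_eq q ⟨hφ.1.trans hlt'.le, hlt⟩]
      congr 4
      refine Multiset.filter_congr fun c hc => ?_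
      constructor
      · intro h1
        by_contra h2
        exact (hφ' c (Multiset.mem_toFinset.mpr hc) (not_le.mp h2)).not_ge h1
      · exact fun h1 =>
          (Real.cos_le_cos_of_nonneg_of_le_pi hφ.1 hlt.le hlt'.le).trans h1

/-- The infimum in the definition of `λ_k` is attained. -/
lemma eigenvalueAt_le_iff (hR : 0 < R.card) {k : ℕ} (hk : 0 < k) (s : ℝ) :
    T.eigenvalueAt k ≤ s ↔ (k : Cardinal) ≤ T.eigenvalueCount s := by
  have hne : {s : ℝ | (k : Cardinal) ≤ T.eigenvalueCount s}.Nonempty :=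
    ⟨_, h.le_eigenvalueCount hR k⟩
  have hbdd : BddBelow {s : ℝ | (k : Cardinal) ≤ T.eigenvalueCount s} := by
    refine ⟨0, fun a ha => ?_⟩
    by_contra hneg
    rw [Set.mem_ofPred_eq, h.eigenvalueCount_of_neg (not_le.mp hneg)] at ha
    have h1 : k ≤ 0 := by exact_mod_cast ha
    omega
  constructor
  · intro hle
    by_contra hlt
    obtain ⟨s', hs', heq⟩ := h.exists_gt_eigenvalueCount_eq s
    obtain ⟨a, ha, has'⟩ := exists_lt_of_csInf_lt hne (lt_of_le_of_lt hle hs')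
    rw [Set.mem_ofPred_eq] at ha
    exact hlt (ha.trans ((T.eigenvalueCount_mono has'.le).trans heq.le))
  · exact fun hs => csInf_le hbdd hs

end LinearPMap.IsTrigSpectrum

/-! ### Spectra of the two Laplace operators -/

namespace MetricGraph

variable {V E : Type*} [Fintype V] [Fintype E] (Γ : MetricGraph V E)

/-- The multiplicity of the eigenvalue `(π i / l)²` for standard vertex conditions. -/
def standardWeight (m i : ℕ) : ℕ := if i = 0 then 1 else if Even i then m + 2 else m

/-- The multiplicity of the eigenvalue `(π i / l)²` for anti-standard vertex conditions. -/
def antiStandardWeight (m i : ℕ) : ℕ := if Even i then m else m + 2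

lemma count_transitionRoots [Nonempty E] {c : ℝ} (hc : c ≠ 1) :
    Γ.transitionRoots.count c = Γ.nontrivialRoots.count c := by
  rw [transitionRoots_eq_cons, Multiset.count_cons_of_ne hc]

lemma count_map_neg (R : Multiset ℝ) (c : ℝ) : (R.map Neg.neg).count c = R.count (-c) := by
  conv_lhs => rw [← neg_neg c]
  exact Multiset.count_map_eq_count' _ _ neg_injective _

section

variable {Γ} {l : ℝ} (hbip : ¬ Γ.graph.IsBipartite) (hl0 : 0 < l) (hl : ∀ e, Γ.len e = l)
include hbip hl0 hl

theorem standardLaplacian_isTrigSpectrum :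
    Γ.standardLaplacian.IsTrigSpectrum l Γ.nontrivialRoots
      (standardWeight (Fintype.card E - Fintype.card V)) := by
  have := Γ.nonempty_edge hbip
  refine ⟨hl0, fun c => Γ.abs_lt_one_of_mem_nontrivialRoots hbip, ?_, ?_, ?_⟩
  · intro μ hμ
    have hκ : 0 < √(-μ) := Real.sqrt_pos.mpr (by linarith)
    have hfund := IsFundamentalPair.of_neg hκ
    rw [Real.sq_sqrt (by linarith), neg_neg] at hfund
    have hsinh : 0 < Real.sinh (√(-μ) * l) := Real.sinh_pos_iff.mpr (by positivity)
    rw [Γ.rank_eigenspaceAt_standardLaplacian hfund hl, Γ.finrank_vertexSpace (by positivity) (by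
      rw [← hfund.sq_add l]; ring), Γ.count_transitionRoots_of_one_lt_abs hbip, Nat.cast_zero]
    rw [abs_of_pos (Real.cosh_pos _)]
    exact Real.one_lt_cosh.mpr (by positivity)
  · intro θ hθ hsin
    have hθ0 : 0 < θ := lt_of_le_of_ne hθ (by rintro rfl; simp at hsin)
    have hfund := IsFundamentalPair.of_pos (div_pos hθ0 hl0)
    have hκ : θ / l ≠ 0 := (div_pos hθ0 hl0).ne'
    have hc1 : Real.cos θ ≠ 1 := by
      intro h1
      have := Real.sin_sq_add_cos_sq θ
      rw [h1] at this
      exact hsin (by nlinarith)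
    rw [Γ.rank_eigenspaceAt_standardLaplacian hfund hl, Γ.finrank_vertexSpace _ (by
      rw [← hfund.sq_add l]; ring)]
    · rw [div_mul_cancel₀ _ hl0.ne', count_transitionRoots _ hc1]
    · rw [div_mul_cancel₀ _ hl0.ne']
      exact div_ne_zero hsin hκ
  · intro i
    unfold standardWeight
    split_ifs with h0 heven
    · subst h0
      have hz : ((0 : ℕ) * Real.pi / l) ^ 2 = 0 := by simp
      rw [hz, Γ.rank_eigenspaceAt_standardLaplacian .zero hl,
        Γ.finrank_vertexSpace hl0.ne' (by simp), Γ.count_one_transitionRoots]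
    all_goals
      have hi : 0 < i * Real.pi := mul_pos (by exact_mod_cast Nat.pos_of_ne_zero h0) Real.pi_pos
      rw [Γ.rank_eigenspaceAt_standardLaplacian (.of_pos (div_pos hi hl0)) hl,
        div_mul_cancel₀ _ hl0.ne', Real.cos_nat_mul_pi, Real.sin_nat_mul_pi, zero_div]
    · rw [heven.neg_one_pow, mul_zero, Γ.finrank_vertexSpace_one hbip]
    · rw [(Nat.not_even_iff_odd.mp heven).neg_one_pow, Γ.finrank_vertexSpace_neg_one hbip]

theorem antiStandardLaplacian_isTrigSpectrum :
    Γ.antiStandardLaplacian.IsTrigSpectrum l (Γ.nontrivialRoots.map Neg.neg)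
      (antiStandardWeight (Fintype.card E - Fintype.card V)) := by
  have := Γ.nonempty_edge hbip
  refine ⟨hl0, ?_, ?_, ?_, ?_⟩
  · intro c hc
    obtain ⟨c', hc', rfl⟩ := Multiset.mem_map.mp hc
    rw [abs_neg]
    exact Γ.abs_lt_one_of_mem_nontrivialRoots hbip hc'
  · intro μ hμ
    have hκ : 0 < √(-μ) := Real.sqrt_pos.mpr (by linarith)
    have hfund := IsFundamentalPair.of_neg hκ
    rw [Real.sq_sqrt (by linarith), neg_neg] at hfund
    have hsinh : 0 < Real.sinh (√(-μ) * l) := Real.sinh_pos_iff.mpr (by positivity)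
    have hs : Real.sinh (√(-μ) * l) / √(-μ) ≠ 0 := by positivity
    rw [Γ.rank_eigenspaceAt_antiStandardLaplacian hfund hl,
      Γ.finrank_vertexSpace (mul_ne_zero hμ.ne hs) (by rw [← hfund.sq_add l]; ring),
      Γ.count_transitionRoots_of_one_lt_abs hbip, Nat.cast_zero]
    rw [abs_neg, abs_of_pos (Real.cosh_pos _)]
    exact Real.one_lt_cosh.mpr (by positivity)
  · intro θ hθ hsin
    have hθ0 : 0 < θ := lt_of_le_of_ne hθ (by rintro rfl; simp at hsin)
    have hfund := IsFundamentalPair.of_pos (div_pos hθ0 hl0)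
    have hκ : θ / l ≠ 0 := (div_pos hθ0 hl0).ne'
    have hc1 : -Real.cos θ ≠ 1 := by
      intro h1
      have := Real.sin_sq_add_cos_sq θ
      rw [← neg_sq (Real.cos θ), h1] at this
      exact hsin (by nlinarith)
    rw [Γ.rank_eigenspaceAt_antiStandardLaplacian hfund hl, Γ.finrank_vertexSpace _ (by
      rw [← hfund.sq_add l]; ring)]
    · rw [div_mul_cancel₀ _ hl0.ne', count_transitionRoots _ hc1, count_map_neg]
    · rw [div_mul_cancel₀ _ hl0.ne']
      exact mul_ne_zero (pow_ne_zero 2 hκ) (div_ne_zero hsin hκ)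
  · intro i
    unfold antiStandardWeight
    by_cases h0 : i = 0
    · subst h0
      have hz : ((0 : ℕ) * Real.pi / l) ^ 2 = 0 := by simp
      rw [hz, Γ.rank_eigenspaceAt_antiStandardLaplacian .zero hl, zero_mul,
        Γ.finrank_vertexSpace_neg_one hbip, if_pos Even.zero]
    have hi : 0 < i * Real.pi := mul_pos (by exact_mod_cast Nat.pos_of_ne_zero h0) Real.pi_pos
    rw [Γ.rank_eigenspaceAt_antiStandardLaplacian (.of_pos (div_pos hi hl0)) hl,
      div_mul_cancel₀ _ hl0.ne', Real.cos_nat_mul_pi, Real.sin_nat_mul_pi, zero_div, mul_zero]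
    split_ifs with heven
    · rw [heven.neg_one_pow, Γ.finrank_vertexSpace_neg_one hbip]
    · rw [(Nat.not_even_iff_odd.mp heven).neg_one_pow, neg_neg, Γ.finrank_vertexSpace_one hbip]

end

end MetricGraph

/-! ### Counting in sorted multisets -/

lemma Multiset.card_filter_map_neg (R : Multiset ℝ) (p : ℝ → Prop) [DecidablePred p] :
    ((R.map Neg.neg).filter p).card = (R.filter fun c => p (-c)).card := by
  rw [Multiset.filter_map, Multiset.card_map]
  rfl

/-- A predicate that passes from the entries of a list to the earlier ones holds for the entry
with the index `k` iff it holds for more than `k` entries. -/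
lemma List.lt_countP_iff {p : ℝ → Prop} [DecidablePred p] {L : List ℝ}
    (hL : L.Pairwise fun a b => p b → p a) {k : ℕ} (hk : k < L.length) :
    k < L.countP (fun a => decide (p a)) ↔ p (L.getD k 0) := by
  induction L generalizing k with
  | nil => simp at hk
  | cons a L ih =>
    rw [List.pairwise_cons] at hL
    by_cases ha : p a
    · rw [List.countP_cons_of_pos (by simpa using ha)]
      cases k with
      | zero => simpa using ha
      | succ k =>
        rw [List.getD_cons_succ, ← ih hL.2 (by simpa using hk)]
        omega
    · have h0 : ∀ b ∈ a :: L, ¬ p b := by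
        intro b hb
        rcases List.mem_cons.mp hb with rfl | hb
        exacts [ha, fun h => ha (hL.1 b hb h)]
      have h1 : (a :: L).countP (fun a => decide (p a)) = 0 :=
        List.countP_eq_zero.mpr fun b hb => by simpa using h0 b hb
      rw [h1]
      refine iff_of_false (by omega) (h0 _ ?_)
      rw [List.getD_eq_getElem _ _ hk]
      exact List.getElem_mem hk

namespace Multiset

variable (R : Multiset ℝ)

/-- The entry with the index `i`, starting from `0`, in the decreasing order. -/
noncomputable def descEntry (i : ℕ) : ℝ := (R.sort (· ≥ ·)).getD i 0

lemma card_filter_eq_countP_sort (p : ℝ → Prop) [DecidablePred p] :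
    (R.filter p).card = (R.sort (· ≥ ·)).countP (fun a => decide (p a)) := by
  conv_lhs => rw [← R.sort_eq (· ≥ ·)]
  rw [← countP_eq_card_filter, coe_countP]

lemma lt_card_filter_ge_iff {k : ℕ} (hk : k < R.card) (t : ℝ) :
    k < (R.filter fun c => t ≤ c).card ↔ t ≤ R.descEntry k := by
  rw [card_filter_eq_countP_sort]
  refine List.lt_countP_iff ?_ (by rwa [length_sort])
  exact (R.pairwise_sort (· ≥ ·)).imp fun hab hb => hb.trans hab

lemma lt_card_filter_le_iff {k : ℕ} (hk : k < R.card) (u : ℝ) :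
    k < (R.filter fun c => c ≤ u).card ↔ R.descEntry (R.card - 1 - k) ≤ u := by
  have h1 : R.card - 1 - k < (R.filter fun c => u < c).card ↔ u < R.descEntry (R.card - 1 - k) := by
    rw [card_filter_eq_countP_sort]
    refine List.lt_countP_iff ?_ (by rw [length_sort]; omega)
    exact (R.pairwise_sort (· ≥ ·)).imp fun hab hb => lt_of_lt_of_le hb hab
  have h2 := congrArg card (filter_add_not (fun c => u < c) R)
  simp only [card_add, not_lt] at h2
  rw [← not_lt, ← h1]
  omega

lemma forall_descEntry_le_neg_iff :
    (∀ i < R.card, R.descEntry i ≤ -R.descEntry (R.card - 1 - i)) ↔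
      ∀ t, (R.filter fun c => t ≤ c).card ≤ (R.filter fun c => c ≤ -t).card := by
  constructor
  · intro h t
    by_contra! hlt
    set k := (R.filter fun c => c ≤ -t).card with hk
    have hkR : k < R.card := hlt.trans_le (card_le_card (filter_le _ _))
    have h1 := (R.lt_card_filter_ge_iff hkR t).mp hlt
    have h2 := (R.lt_card_filter_le_iff hkR (-t)).mpr (by linarith [h k hkR])
    omega
  · intro h i hi
    have h1 := (R.lt_card_filter_ge_iff hi _).mpr le_rfl
    have h2 := (R.lt_card_filter_le_iff hi _).mp (h1.trans_le (h _))
    linarith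

lemma forall_descEntry_ge_neg_iff :
    (∀ i, i + 2 < R.card → R.descEntry i ≥ -R.descEntry (R.card - 3 - i)) ↔
      ∀ t, (R.filter fun c => c ≤ -t).card ≤ (R.filter fun c => t ≤ c).card + 2 := by
  have hidx : ∀ i, R.card - 1 - (i + 2) = R.card - 3 - i := fun i => by omega
  constructor
  · intro h t
    by_contra! hlt
    set k := (R.filter fun c => t ≤ c).card with hk
    have hkR : k + 2 < R.card := hlt.trans_le (card_le_card (filter_le _ _))
    have h1 := (R.lt_card_filter_le_iff hkR (-t)).mp hlt
    rw [hidx] at h1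
    have h2 := (R.lt_card_filter_ge_iff (by omega : k < R.card) t).mpr (by linarith [h k hkR])
    omega
  · intro h i hi
    have h1 := (R.lt_card_filter_le_iff hi (R.descEntry (R.card - 3 - i))).mpr (by rw [hidx])
    have h2 := h (-R.descEntry (R.card - 3 - i))
    rw [neg_neg] at h2
    exact (R.lt_card_filter_ge_iff (by omega : i < R.card) _).mp (by omega)

end Multiset

/-! ### Comparison of the counting functions -/

namespace MetricGraph

/-- The two kinds of conditions differ in the multiplicities at the points `π i`: the difference of
the partial sums is `m - 1` or `m + 1`. -/
lemma sum_antiStandardWeight (m q : ℕ) :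
    ∑ i ∈ Finset.range (q + 1), antiStandardWeight m i + 1 =
      ∑ i ∈ Finset.range (q + 1), standardWeight m i + m + if Even q then 0 else 2 := by
  induction q with
  | zero => simp [antiStandardWeight, standardWeight, add_comm]
  | succ q ih =>
    rw [Finset.sum_range_succ, Finset.sum_range_succ (standardWeight m)]
    by_cases hq : Even q
    · have hq1 : ¬ Even (q + 1) := by rwa [Nat.even_add_one, not_not]
      simp only [antiStandardWeight, standardWeight, hq, hq1, if_true, if_false,
        q.succ_ne_zero] at ih ⊢
      omega
    · have hq1 : Even (q + 1) := by rwa [Nat.even_add_one]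
      simp only [antiStandardWeight, standardWeight, hq, hq1, if_true, if_false,
        q.succ_ne_zero] at ih ⊢
      omega

variable {V E : Type*} [Fintype V] [Fintype E] (Γ : MetricGraph V E)

/-- Since `μ_1 = 1`, the other eigenvalues `μ_2, μ_3, …` are the decreasingly ordered entries of
`nontrivialRoots`. -/
lemma transitionEigenvalue_add_two [Nonempty E] (hbip : ¬ Γ.graph.IsBipartite) (i : ℕ) :
    Γ.transitionEigenvalue (i + 2) = Γ.nontrivialRoots.descEntry i := by
  have h1 : Γ.transitionEigenvalue (i + 2) = (Γ.transitionRoots.sort (· ≥ ·)).getD (i + 1) 0 := rfl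
  rw [h1, transitionRoots_eq_cons, Multiset.sort_cons, List.getD_cons_succ]
  · rfl
  · exact fun c hc => (abs_lt.mp (Γ.abs_lt_one_of_mem_nontrivialRoots hbip hc)).2.le

end MetricGraph

theorem mainTheorem3 {V E : Type*} [Fintype V] [Fintype E] (Γ : MetricGraph V E)
    (hequi : Γ.IsEquilateral) (hbip : ¬ Γ.graph.IsBipartite) :
    (∀ k : ℕ, 1 ≤ k →
      Γ.standardLaplacian.eigenvalueAt (k + 1) ≥
        Γ.antiStandardLaplacian.eigenvalueAt (k + Fintype.card E - Fintype.card V)) ↔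
    ((∀ j ∈ Finset.Icc 2 (Fintype.card V),
        Γ.transitionEigenvalue j ≤ -Γ.transitionEigenvalue (Fintype.card V + 2 - j)) ∧
      (∀ j ∈ Finset.Icc 2 (Fintype.card V - 2),
        Γ.transitionEigenvalue j ≥ -Γ.transitionEigenvalue (Fintype.card V - j))) := by
  obtain ⟨e₀⟩ := Γ.nonempty_edge hbip
  have : Nonempty E := ⟨e₀⟩
  have hVE := Γ.card_vertex_le_card_edge hbip
  have hst := MetricGraph.standardLaplacian_isTrigSpectrum hbip (Γ.len_pos e₀) (hequi · e₀)
  have han := MetricGraph.antiStandardLaplacian_isTrigSpectrum hbip (Γ.len_pos e₀) (hequi · e₀)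
  have hcard := Γ.card_nontrivialRoots
  have hent := Γ.transitionEigenvalue_add_two hbip
  have habs : ∀ c ∈ Γ.nontrivialRoots, |c| < 1 :=
    fun c => Γ.abs_lt_one_of_mem_nontrivialRoots hbip
  set R := Γ.nontrivialRoots with hR
  set n := Fintype.card V with hn
  set m := Fintype.card E - n with hm
  have hn2 : 1 < n := Fintype.one_lt_card_iff.mpr ⟨_, _, Γ.no_loop e₀⟩
  have hR0 : 0 < R.card := by omega
  -- the inequalities between the entries of the sorted list, for the nontrivial eigenvalues
  have hA : (∀ j ∈ Finset.Icc 2 n, Γ.transitionEigenvalue j ≤ -Γ.transitionEigenvalue (n + 2 - j)) ↔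
      ∀ i < R.card, R.descEntry i ≤ -R.descEntry (R.card - 1 - i) := by
    constructor
    · intro h i hi
      have h1 := h (i + 2) (Finset.mem_Icc.mpr ⟨by omega, by omega⟩)
      rwa [show n + 2 - (i + 2) = (R.card - 1 - i) + 2 by omega, hent, hent] at h1
    · intro h j hj
      rw [Finset.mem_Icc] at hj
      obtain ⟨i, rfl⟩ := Nat.exists_eq_add_of_le' hj.1
      rw [show n + 2 - (i + 2) = (R.card - 1 - i) + 2 by omega, hent, hent]
      exact h i (by omega)
  have hB : (∀ j ∈ Finset.Icc 2 (n - 2),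
      Γ.transitionEigenvalue j ≥ -Γ.transitionEigenvalue (n - j)) ↔
      ∀ i, i + 2 < R.card → R.descEntry i ≥ -R.descEntry (R.card - 3 - i) := by
    constructor
    · intro h i hi
      have h1 := h (i + 2) (Finset.mem_Icc.mpr ⟨by omega, by omega⟩)
      rwa [show n - (i + 2) = (R.card - 3 - i) + 2 by omega, hent, hent] at h1
    · intro h j hj
      rw [Finset.mem_Icc] at hj
      obtain ⟨i, rfl⟩ := Nat.exists_eq_add_of_le' hj.1
      rw [show n - (i + 2) = (R.card - 3 - i) + 2 by omega, hent, hent]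
      exact h i (by omega)
  rw [hA, hB, R.forall_descEntry_le_neg_iff, R.forall_descEntry_ge_neg_iff]
  -- the inequalities between the eigenvalues, in terms of the counting functions
  have hcount : (∀ k : ℕ, 1 ≤ k → Γ.standardLaplacian.eigenvalueAt (k + 1) ≥
        Γ.antiStandardLaplacian.eigenvalueAt (k + Fintype.card E - n)) ↔
      ∀ k : ℕ, 1 ≤ k → ∀ s, ((k + 1 : ℕ) : Cardinal) ≤ Γ.standardLaplacian.eigenvalueCount s →
        ((k + m : ℕ) : Cardinal) ≤ Γ.antiStandardLaplacian.eigenvalueCount s := by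
    refine forall₂_congr fun k hk => ?_
    rw [show k + Fintype.card E - n = k + m by omega, ge_iff_le, ← forall_ge_iff_le]
    refine forall_congr' fun s => ?_
    rw [hst.eigenvalueAt_le_iff hR0 k.succ_pos,
      han.eigenvalueAt_le_iff (by rwa [Multiset.card_map]) (by omega)]
  rw [hcount]
  have hst_eq := fun q φ hφ => hst.eigenvalueCount_eq q (φ := φ) hφ
  have han_eq := fun q φ hφ => han.eigenvalueCount_eq q (φ := φ) hφ
  simp only [Multiset.card_filter_map_neg, Multiset.card_map] at han_eq
  have hW := MetricGraph.sum_antiStandardWeight m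
  have hW0 : ∀ q, 1 ≤ ∑ i ∈ Finset.range (q + 1), MetricGraph.standardWeight m i := fun q =>
    Finset.single_le_sum (f := MetricGraph.standardWeight m) (fun _ _ => Nat.zero_le _)
      (Finset.mem_range.mpr q.succ_pos)
  -- the condition at `θ = φ + q π`, according to the parity of `q`
  have heven : ∀ q : ℕ, Even q → ∀ φ ∈ Set.Ico 0 Real.pi,
      ((∀ k : ℕ, 1 ≤ k → ((k + 1 : ℕ) : Cardinal) ≤
          Γ.standardLaplacian.eigenvalueCount (((φ + q * Real.pi) / Γ.len e₀) ^ 2) →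
        ((k + m : ℕ) : Cardinal) ≤
          Γ.antiStandardLaplacian.eigenvalueCount (((φ + q * Real.pi) / Γ.len e₀) ^ 2)) ↔
      (R.filter fun c => Real.cos φ ≤ c).card ≤ (R.filter fun c => c ≤ -Real.cos φ).card) := by
    intro q hq φ hφ
    have h1 := hW q
    have h2 := hW0 q
    rw [if_pos hq] at h1
    simp only [hst_eq q φ hφ, han_eq q φ hφ, Nat.cast_le, hq.neg_one_pow, one_mul,
      le_neg (a := Real.cos φ)]
    constructor
    · intro h
      by_contra! hlt
      -- `k + 1` is the number of eigenvalues up to `θ` for standard conditions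
      have := h (∑ i ∈ Finset.range (q + 1), MetricGraph.standardWeight m i + (q * R.card +
        (R.filter fun c => Real.cos φ ≤ c).card) - 1) (by omega) (by omega)
      omega
    · intro h k hk hle
      omega
  have hodd : ∀ q : ℕ, ¬ Even q → ∀ φ ∈ Set.Ico 0 Real.pi,
      ((∀ k : ℕ, 1 ≤ k → ((k + 1 : ℕ) : Cardinal) ≤
          Γ.standardLaplacian.eigenvalueCount (((φ + q * Real.pi) / Γ.len e₀) ^ 2) →
        ((k + m : ℕ) : Cardinal) ≤
          Γ.antiStandardLaplacian.eigenvalueCount (((φ + q * Real.pi) / Γ.len e₀) ^ 2)) ↔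
      (R.filter fun c => c ≤ -Real.cos φ).card ≤
        (R.filter fun c => Real.cos φ ≤ c).card + 2) := by
    intro q hq φ hφ
    have h1 := hW q
    have h2 := hW0 q
    rw [if_neg hq] at h1
    simp only [hst_eq q φ hφ, han_eq q φ hφ, Nat.cast_le,
      (Nat.not_even_iff_odd.mp hq).neg_one_pow, neg_mul, one_mul, neg_neg,
      le_neg (a := Real.cos φ)]
    constructor
    · intro h
      by_contra! hlt
      have := h (∑ i ∈ Finset.range (q + 1), MetricGraph.standardWeight m i + (q * R.card +
        (R.filter fun c => c ≤ -Real.cos φ).card) - 1) (by omega) (by omega)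
      omega
    · intro h k hk hle
      omega
  constructor
  · intro h
    -- for `-1 < t ≤ 1` take `θ = arccos t` and `θ = arccos t + π`; other `t` are trivial
    have hφ : ∀ t : ℝ, -1 < t → t ≤ 1 →
        Real.arccos t ∈ Set.Ico 0 Real.pi ∧ Real.cos (Real.arccos t) = t := fun t h1 h2 =>
      ⟨⟨Real.arccos_nonneg t, Real.arccos_lt_pi.mpr h1⟩, Real.cos_arccos h1.le h2⟩
    have hlow : ∀ t : ℝ, t ≤ -1 → R.filter (fun c => c ≤ -t) = R ∧
        R.filter (fun c => t ≤ c) = R := fun t ht => by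
      constructor <;> refine Multiset.filter_eq_self.mpr fun c hc => ?_
      · linarith [(abs_lt.mp (habs c hc)).2]
      · linarith [(abs_lt.mp (habs c hc)).1]
    have hhigh : ∀ t : ℝ, 1 < t → R.filter (fun c => c ≤ -t) = 0 ∧
        R.filter (fun c => t ≤ c) = 0 := fun t ht => by
      constructor <;> refine Multiset.filter_eq_nil.mpr fun c hc => ?_
      · linarith [(abs_lt.mp (habs c hc)).1]
      · linarith [(abs_lt.mp (habs c hc)).2]
    constructor <;> intro t
    · rcases le_or_gt t (-1) with h1 | h1
      · rw [(hlow t h1).1, (hlow t h1).2]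
      rcases le_or_gt t 1 with h2 | h2
      · obtain ⟨h3, h4⟩ := hφ t h1 h2
        have h5 := (heven 0 Even.zero _ h3).mp fun k hk => h k hk _
        rwa [h4] at h5
      · rw [(hhigh t h2).1, (hhigh t h2).2]
    · rcases le_or_gt t (-1) with h1 | h1
      · rw [(hlow t h1).1, (hlow t h1).2]
        omega
      rcases le_or_gt t 1 with h2 | h2
      · obtain ⟨h3, h4⟩ := hφ t h1 h2
        have h5 := (hodd 1 Nat.not_even_one _ h3).mp fun k hk => h k hk _
        rwa [h4] at h5
      · rw [(hhigh t h2).1, (hhigh t h2).2]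
        omega
  · rintro ⟨h1, h2⟩ k hk s
    rcases neg_or_exists_sq_eq (Γ.len_pos e₀) s with hs | ⟨q, φ, hφ, rfl⟩
    · rw [hst.eigenvalueCount_of_neg hs]
      intro h3
      have h4 : k + 1 ≤ 0 := by exact_mod_cast h3
      omega
    · by_cases hq : Even q
      · exact (heven q hq φ hφ).mpr (h1 _) k hk
      · exact (hodd q hq φ hφ).mpr (h2 _) k hk
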